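/- Let $n\ge 0$, let $\alpha=(\alpha_1,\dots,\alpha_n)$ be a weak composition ($\alpha_r\in\mathbb{Z}_{\ge 0}$) and let $\sigma\in S_n$. **Fillings.** The augmented diagram of $\alpha$ has the boxes $(r,c)$ with $1\le r\le n$, $0\le c\le\alpha_r$ (row $r$, counted from top to bottom; column $c$, counted from left to right); column $0$ is the basement. For a non-basement box $u=(r,c)$ put $d(u)=(r,c-1)$. Let $\mathrm{NAF}_\sigma(\alpha)$ be the set of fillings $F$ of the augmented diagram with entries in $\{1,\dots,n\}$ such that $F(r,0)=\sigma_r$ for all $r$, and such that no two boxes $(r,c)$, $(r',c')$ with $r<r'$ and $c'\in\{c,c+1\}$ have equal entries. Define: * $\operatorname{leg}(r,c)=\alpha_r-c$, and $\operatorname{arm}(r,c)=\#\{r'>r: c\le\alpha_{r'}\le\alpha_r\}+\#\{r'<r: c-1\le\alpha_{r'}<\alpha_r\}$ for $c\ge1$; * $\operatorname{maj}F=\sum(\operatorname{leg}(u)+1)$, over the non-basement boxes $u$ with $F(d(u))<F(u)$; * a triple of type $A$ consists of boxes $a=(r,c-1)$, $b=(r,c)$, $c_0=(r',c)$ of the augmented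 diagram with $c\ge1$, $r'>r$, $\alpha_{r'}\le\alpha_r$; a triple of type $B$ consists of boxes $a=(r,c-1)$, $b=(r,c)$, $c_0=(r',c-1)$ with $c\ge1$, $r'<r$, $\alpha_{r'}<\alpha_r$. Comparing entries, with ties broken by $b<c_0<a$, the triple is an inversion triple if $F(a),F(c_0),F(b)$ is increasing up to cyclic rotation. (This means that the entries in increasing order run counter-clockwise for type $A$ and clockwise for type $B$.) $\operatorname{coinv}F$ is the number of triples of type $A$ or $B$ that are not inversion triples. **The $t$-atoms.** The permuted-basement Macdonald polynomial is $$\mathrm{E}^\sigma_\alpha(\mathbf{x};q,t)=\sum_{F\in\mathrm{NAF}_\sigma(\alpha)}\mathbf{x}^F q^{\operatorname{maj}F}t^{\operatorname{coinv}F}\prod_{u:\,F(d(u))\ne F(u)}\frac{1-t}{1-q^{1+\operatorname{leg}u}t^{1+\operatorname{arm}u}},$$ where the product is over non-basement boxes $u$ and $\mathbf{x}^F=\prod_u x_{F(u)}$ over all non-basement boxes $u$. The permuted-basement $t$-atom is $\mathcal{A}^\sigma_\alpha(\mathbf{x};t)=\mathrm{E}^\sigma_\alpha(\mathbf{x};0,t)$.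 **Operators.** For $1\le i<n$ let $s_i$ exchange the variables $x_i$ and $x_{i+1}$, and put $$\partial_i f=\frac{f-s_if}{x_i-x_{i+1}},\quad \pi_i f=\partial_i(x_if),\quad \theta_i f=\pi_i f-f,$$ $$\tilde\pi_i f=(1-t)\pi_i f+t\,s_i f,\qquad \tilde\theta_i f=(1-t)\theta_i f+t\,s_i f.$$ **Proposition.** Given $\alpha$ and $\sigma$, there is a finite (possibly empty) sequence $\tilde\rho_{i_1},\dots,\tilde\rho_{i_\ell}$, in which each $\tilde\rho_{i}$ is one of the symbols $\tilde\theta_{i}$ or $\tilde\pi_{i}$ with $1\le i<n$, such that $$\mathcal{A}^\sigma_\alpha(\mathbf{x};t)=\tilde\rho_{i_1}\cdots\tilde\rho_{i_\ell}\,\mathbf{x}^\lambda,$$ where $\lambda$ is the partition with the parts of $\alpha$ in decreasing order and $\mathbf{x}^\lambda=x_1^{\lambda_1}\cdots x_n^{\lambda_n}$. The sequence depends only on $\alpha$ and $\sigma$, and the identity holds in $K[x_1,\dots,x_n]$ for every field $K$ and every $t\in K$ (in particular for $t$ an indeterminate). -/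

import Mathlib

namespace PermutedBasement

/-! ## Augmented diagrams and fillings

Rows and labels are indexed by `Fin n` (so `0, …, n-1` instead of `1, …, n`); row `r` is drawn above
row `r'` when `r < r'` (English notation). A weak composition with `n` parts is `α : Fin n → ℕ`. -/

/-- The boxes `(row, column)` of the augmented diagram of `α`; column `0` is the basement, and
row `r` has the columns `0, …, α r`. -/
abbrev Box {n : ℕ} (α : Fin n → ℕ) : Type := (r : Fin n) × Fin (α r + 1)

/-- The non-basement boxes: `⟨r, k⟩` stands for the box in row `r` and column `k + 1`. -/
abbrev Cell {n : ℕ} (α : Fin n → ℕ) : Type := (r : Fin n) × Fin (α r)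

variable {n : ℕ} {α : Fin n → ℕ}

/-- The row of a box. -/
def Box.row (u : Box α) : Fin n := u.1

/-- The column of a box. -/
def Box.col (u : Box α) : ℕ := u.2.val

/-- A non-basement box `u`, as a box of the augmented diagram. -/
def Cell.box (u : Cell α) : Box α := ⟨u.1, u.2.succ⟩

/-- The box `d(u)` immediately to the left of the non-basement box `u`. -/
def Cell.left (u : Cell α) : Box α := ⟨u.1, u.2.castSucc⟩

/-- The augmented filling with basement `σ` whose non-basement entries are given by `F`. -/
def augment (σ : Equiv.Perm (Fin n)) (F : Cell α → Fin n) : Box α → Fin n :=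
  fun u => Fin.cases (motive := fun _ => Fin n) (σ u.1) (fun k => F ⟨u.1, k⟩) u.2

theorem augment_box (σ : Equiv.Perm (Fin n)) (F : Cell α → Fin n) (u : Cell α) :
    augment σ F (Cell.box u) = F u := rfl

theorem augment_basement (σ : Equiv.Perm (Fin n)) (F : Cell α → Fin n) (r : Fin n) :
    augment σ F ⟨r, 0⟩ = σ r := rfl

/-- The boxes `a`, `b` are attacking in the augmented filling `G`: they have equal entries, and are
either two boxes of the same column, `a` above `b`, or `b` is in the column just to the right of
that of `a`, in a row strictly below. -/
def Attacking (G : Box α → Fin n) (a b : Box α) : Prop :=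
  G a = G b ∧ Box.row a < Box.row b ∧ (Box.col a = Box.col b ∨ Box.col a + 1 = Box.col b)

/-- No pair of boxes is attacking. -/
def NonAttacking (G : Box α → Fin n) : Prop := ∀ a b : Box α, ¬ Attacking G a b

/-- `a` is immediately to the left of `b`. -/
def ImmLeft (a b : Box α) : Prop := Box.row a = Box.row b ∧ Box.col a + 1 = Box.col b

/-- Triples of type `A`: `a` is immediately to the left of `b`, `c` is below `b` in the same column,
and the row of `a`, `b` is at least as long as that of `c`. -/
def TypeA (a b c : Box α) : Prop :=
  ImmLeft a b ∧ Box.col c = Box.col b ∧ Box.row b < Box.row c ∧ α (Box.row c) ≤ α (Box.row b)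

/-- Triples of type `B`: `a` is immediately to the left of `b`, `c` is above `a` in the same column,
and the row of `a`, `b` is strictly longer than that of `c`. -/
def TypeB (a b c : Box α) : Prop :=
  ImmLeft a b ∧ Box.col c = Box.col a ∧ Box.row c < Box.row a ∧ α (Box.row c) < α (Box.row a)

/-- `x, y, z` is, up to cyclic rotation, strictly increasing. -/
def CycIncreasing {L : Type*} [LT L] (x y z : L) : Prop :=
  (x < y ∧ y < z) ∨ (y < z ∧ z < x) ∨ (z < x ∧ x < y)

/-- The inversion condition for a triple `a`, `b`, `c`. Ties between equal entries are broken by the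
subscripts `a₃`, `b₁`, `c₂`, larger subscripts counting as larger. In a type `A` triple
(`a` top left, `b` top right, `c` bottom right) one meets `a, c, b` in this order when going around
counter-clockwise; in a type `B` triple (`c` top left, `a` bottom left, `b` bottom right) one meets
`a, c, b` in this order when going around clockwise. So in both cases the inversion triples are
those in which the entries of `a, c, b` are cyclically increasing. -/
def InversionTriple (G : Box α → Fin n) (a b c : Box α) : Prop :=
  CycIncreasing (toLex (G a, 3) : Fin n ×ₗ ℕ) (toLex (G c, 2)) (toLex (G b, 1))

/-- The number of coinversions: type `A` and type `B` triples that are not inversion triples. -/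
noncomputable def coinv (G : Box α → Fin n) : ℕ :=
  Nat.card {p : Box α × Box α × Box α //
    (TypeA p.1 p.2.1 p.2.2 ∨ TypeB p.1 p.2.1 p.2.2) ∧ ¬ InversionTriple G p.1 p.2.1 p.2.2}

/-- The number of boxes to the right of `u`. -/
def leg (u : Box α) : ℕ := α (Box.row u) - Box.col u

/-- The arm of a box. -/
noncomputable def arm (u : Box α) : ℕ :=
  Nat.card {v : Box α //
    (Box.col v = Box.col u ∧ Box.row u < Box.row v ∧ α (Box.row v) ≤ α (Box.row u)) ∨
    (Box.col v + 1 = Box.col u ∧ Box.row v < Box.row u ∧ α (Box.row v) < α (Box.row u))}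

/-- The major index: the sum of `leg u + 1` over the descents, that is, the non-basement boxes `u`
with `G (d(u)) < G u`. -/
def maj (G : Box α → Fin n) : ℕ :=
  ∑ u : Cell α, if G (Cell.left u) < G (Cell.box u) then leg (Cell.box u) + 1 else 0

open scoped Classical in
/-- `NAF_σ(α)`: the fillings of shape `α` with entries among the `n` labels that are non-attacking
when augmented with the basement `σ`. -/
noncomputable def NAF (σ : Equiv.Perm (Fin n)) (α : Fin n → ℕ) : Finset (Cell α → Fin n) :=
  Finset.univ.filter fun F => NonAttacking (augment σ F)

/-! ## Permuted-basement Macdonald polynomials and `t`-atoms -/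

/-- The permuted-basement Macdonald polynomial `E^σ_α(x; q, t)`. -/
noncomputable def macdonaldE {K : Type*} [Field K] (σ : Equiv.Perm (Fin n)) (α : Fin n → ℕ)
    (q t : K) : MvPolynomial (Fin n) K :=
  ∑ F ∈ NAF σ α,
    MvPolynomial.C (q ^ maj (augment σ F) * t ^ coinv (augment σ F) *
      ∏ u : Cell α,
        if augment σ F (Cell.left u) ≠ augment σ F (Cell.box u) then
          (1 - t) / (1 - q ^ (1 + leg (Cell.box u)) * t ^ (1 + arm (Cell.box u)))
        else 1) *
    ∏ u : Cell α, MvPolynomial.X (F u)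

/-- The permuted-basement `t`-atom `A^σ_α(x; t) = E^σ_α(x; 0, t)` (at `q = 0` all the denominators
are equal to `1`). -/
noncomputable def tAtom {K : Type*} [Field K] (σ : Equiv.Perm (Fin n)) (α : Fin n → ℕ) (t : K) :
    MvPolynomial (Fin n) K :=
  macdonaldE σ α 0 t

/-! ## Demazure–Lusztig operators -/

/-- The position `i`, for an index `i` of a simple transposition `s_i`. -/
def pos (i : Fin (n - 1)) : Fin n := ⟨i.val, by omega⟩

/-- The position `i + 1`, for an index `i` of a simple transposition `s_i`. -/
def posSucc (i : Fin (n - 1)) : Fin n := ⟨i.val + 1, by omega⟩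

section Operators

variable {K : Type*} [Field K]

/-- `s_i` exchanges the variables `x_i` and `x_{i+1}`. -/
noncomputable def simpleSwap (i : Fin (n - 1)) (f : MvPolynomial (Fin n) K) :
    MvPolynomial (Fin n) K :=
  MvPolynomial.rename (Equiv.swap (pos i) (posSucc i)) f

theorem dvd_sub_simpleSwap (i : Fin (n - 1)) (f : MvPolynomial (Fin n) K) :
    (MvPolynomial.X (pos i) - MvPolynomial.X (posSucc i) : MvPolynomial (Fin n) K) ∣
      f - simpleSwap i f := by
  unfold simpleSwap
  induction f using MvPolynomial.induction_on with
  | C a => simp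
  | add p q hp hq =>
    rw [map_add, add_sub_add_comm]
    exact dvd_add hp hq
  | mul_X p j hp =>
    rw [map_mul, MvPolynomial.rename_X]
    have hX : (MvPolynomial.X (pos i) - MvPolynomial.X (posSucc i) : MvPolynomial (Fin n) K) ∣
        MvPolynomial.X j - MvPolynomial.X (Equiv.swap (pos i) (posSucc i) j) := by
      by_cases h1 : j = pos i
      · subst h1; simp
      · by_cases h2 : j = posSucc i
        · subst h2
          rw [Equiv.swap_apply_right]
          exact ⟨-1, by ring⟩
        · rw [Equiv.swap_apply_of_ne_of_ne h1 h2]; simp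
    have e : p * MvPolynomial.X j - MvPolynomial.rename (Equiv.swap (pos i) (posSucc i)) p *
          MvPolynomial.X (Equiv.swap (pos i) (posSucc i) j) =
        (p - MvPolynomial.rename (Equiv.swap (pos i) (posSucc i)) p) * MvPolynomial.X j +
          MvPolynomial.rename (Equiv.swap (pos i) (posSucc i)) p *
          (MvPolynomial.X j - MvPolynomial.X (Equiv.swap (pos i) (posSucc i) j)) := by ring
    rw [e]
    exact dvd_add (Dvd.dvd.mul_right hp _) (Dvd.dvd.mul_left hX _)

/-- The divided difference `∂_i f = (f - s_i f) / (x_i - x_{i+1})`. -/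
noncomputable def divDiff (i : Fin (n - 1)) (f : MvPolynomial (Fin n) K) :
    MvPolynomial (Fin n) K :=
  (dvd_sub_simpleSwap i f).choose

theorem mul_divDiff (i : Fin (n - 1)) (f : MvPolynomial (Fin n) K) :
    (MvPolynomial.X (pos i) - MvPolynomial.X (posSucc i)) * divDiff i f = f - simpleSwap i f :=
  (dvd_sub_simpleSwap i f).choose_spec.symm

/-- The operator `π_i = ∂_i x_i`. -/
noncomputable def piOp (i : Fin (n - 1)) (f : MvPolynomial (Fin n) K) : MvPolynomial (Fin n) K :=
  divDiff i (MvPolynomial.X (pos i) * f)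

/-- The operator `θ_i = π_i - 1`. -/
noncomputable def thetaOp (i : Fin (n - 1)) (f : MvPolynomial (Fin n) K) :
    MvPolynomial (Fin n) K :=
  piOp i f - f

/-- The operator `π̃_i(f) = (1 - t) π_i(f) + t s_i(f)`. -/
noncomputable def piTilde (t : K) (i : Fin (n - 1)) (f : MvPolynomial (Fin n) K) :
    MvPolynomial (Fin n) K :=
  MvPolynomial.C (1 - t) * piOp i f + MvPolynomial.C t * simpleSwap i f

/-- The operator `θ̃_i(f) = (1 - t) θ_i(f) + t s_i(f)`. -/
noncomputable def thetaTilde (t : K) (i : Fin (n - 1)) (f : MvPolynomial (Fin n) K) :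
    MvPolynomial (Fin n) K :=
  MvPolynomial.C (1 - t) * thetaOp i f + MvPolynomial.C t * simpleSwap i f

end Operators

/-- The letters of operator words: the symbols `θ̃_i` and `π̃_i`, for `i` the index of a simple
transposition. -/
inductive Letter (n : ℕ) : Type
  | theta (i : Fin (n - 1)) : Letter n
  | pi (i : Fin (n - 1)) : Letter n

/-- The operator denoted by a letter. -/
noncomputable def Letter.apply {K : Type*} [Field K] (t : K) :
    Letter n → MvPolynomial (Fin n) K → MvPolynomial (Fin n) K
  | .theta i => thetaTilde t i
  | .pi i => piTilde t i

/-- The word `ρ_1 ρ_2 ⋯ ρ_ℓ` applied to `f`, that is `ρ_1 (ρ_2 (⋯ (ρ_ℓ f)))`. -/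
noncomputable def applyWord {K : Type*} [Field K] (t : K) (w : List (Letter n))
    (f : MvPolynomial (Fin n) K) : MvPolynomial (Fin n) K :=
  w.foldr (fun ρ g => Letter.apply t ρ g) f

/-! ## The partition of a composition -/

/-- The partition with the parts of `α` in decreasing order. -/
def decRearrangement (α : Fin n → ℕ) : Fin n → ℕ :=
  fun r => α (Tuple.sort α (Fin.rev r))

theorem decRearrangement_antitone (α : Fin n → ℕ) : Antitone (decRearrangement α) :=
  fun _ _ h => Tuple.monotone_sort α (Fin.rev_le_rev.2 h)

theorem decRearrangement_eq_comp_perm (α : Fin n → ℕ) :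
    ∃ τ : Equiv.Perm (Fin n), decRearrangement α = α ∘ τ :=
  ⟨Fin.revPerm.trans (Tuple.sort α), rfl⟩

/-- The monomial `x_1^{λ_1} ⋯ x_n^{λ_n}`. -/
noncomputable def xPow (K : Type*) [Field K] (lam : Fin n → ℕ) : MvPolynomial (Fin n) K :=
  ∏ r : Fin n, MvPolynomial.X r ^ lam r

end PermutedBasement

/-!
# Permuted-basement `t`-atoms and Demazure–Lusztig operators

At `q = 0` only the fillings with weakly decreasing rows survive, and a filling can be built one box
at a time: column by column, each column from bottom to top. What matters for the remaining boxes is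
the *queue* of unfinished rows, in the order in which they receive their next box; each row is
recorded by its number of boxes left and its last entry (its label). The labels stay distinct: the
non-attacking condition on a new box says exactly that its entry is not the label of another row in
the queue, and a row with `j` boxes left forms a coinversion with a row passing from the label `a`
to `b`, leaving `k` boxes, exactly when `j ≤ k` and its label lies strictly between `b` and `a`. So
the `t`-atom is the generating function `queueSum` of the initial queue (`tAtom_eq_queueSum`), and
`queueSum` satisfies a one-box recursion that makes sense for all queues.

The key fact (`queueSum_swapLabels`) is that exchanging the labels `i` and `i + 1` in a queue acts
on `queueSum` as `π̃_i` or `θ̃_i`. The operator is `π̃_i` if `i + 1` is not a label, or if it comes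
before `i` with at most as many boxes left; it is `θ̃_i` if `i` comes before `i + 1` with strictly
more boxes left. This follows by induction along the recursion from the relations
`θ̃_i x_i = x_{i+1} π̃_i`, `π̃_i x_{i+1} = x_i θ̃_i`, `θ̃_i π̃_i = t` and `π̃_i = θ̃_i + (1 - t)`.

Call a row dominant over another if it is longer, or equally long and higher. If the row with the
label `i + 1` dominates the row with the label `i` in the basement `σ`, the `t`-atom of `σ` is
therefore `π̃_i` or `θ̃_i` applied to the one of the basement with these labels exchanged. Each such
exchange decreases the number of misplaced pairs of labels. When none is left, every row has to be
constant, because all smaller labels are in use (`queueSum_of_labelOrdered`), and the `t`-atom is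
the monomial `x^λ`.
-/

namespace PermutedBasement

/-! ### Relations between the operators -/

section OperatorRelations

variable {n : ℕ} {K : Type*} [Field K]

theorem pos_lt_posSucc (i : Fin (n - 1)) : pos i < posSucc i :=
  Fin.mk_lt_mk.2 (Nat.lt_succ_self _)

theorem X_pos_sub_X_posSucc_ne_zero (i : Fin (n - 1)) :
    (MvPolynomial.X (pos i) - MvPolynomial.X (posSucc i) : MvPolynomial (Fin n) K) ≠ 0 :=
  sub_ne_zero.2 fun h => (pos_lt_posSucc i).ne (MvPolynomial.X_injective h)

theorem mul_piTilde (t : K) (i : Fin (n - 1)) (f : MvPolynomial (Fin n) K) :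
    (MvPolynomial.X (pos i) - MvPolynomial.X (posSucc i)) * piTilde t i f =
      (1 - MvPolynomial.C t) * MvPolynomial.X (pos i) * f +
        (MvPolynomial.C t * MvPolynomial.X (pos i) - MvPolynomial.X (posSucc i)) *
          simpleSwap i f := by
  have h := mul_divDiff i (MvPolynomial.X (pos i) * f)
  have e : simpleSwap i (MvPolynomial.X (pos i) * f) =
      MvPolynomial.X (posSucc i) * simpleSwap i f := by
    simp [simpleSwap]
  rw [e] at h
  simp only [piTilde, piOp, map_sub, map_one]
  linear_combination (1 - MvPolynomial.C t) * h

theorem piTilde_eq_thetaTilde_add (t : K) (i : Fin (n - 1)) (f : MvPolynomial (Fin n) K) :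
    piTilde t i f = thetaTilde t i f + (1 - MvPolynomial.C t) * f := by
  simp only [piTilde, thetaTilde, thetaOp, map_sub, map_one]
  ring

theorem mul_thetaTilde (t : K) (i : Fin (n - 1)) (f : MvPolynomial (Fin n) K) :
    (MvPolynomial.X (pos i) - MvPolynomial.X (posSucc i)) * thetaTilde t i f =
      (1 - MvPolynomial.C t) * MvPolynomial.X (posSucc i) * f +
        (MvPolynomial.C t * MvPolynomial.X (pos i) - MvPolynomial.X (posSucc i)) *
          simpleSwap i f := by
  linear_combination mul_piTilde t i f - (MvPolynomial.X (pos i) - MvPolynomial.X (posSucc i)) *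
    piTilde_eq_thetaTilde_add t i f

theorem piTilde_mul_of_simpleSwap_eq (t : K) (i : Fin (n - 1)) {g : MvPolynomial (Fin n) K}
    (hg : simpleSwap i g = g) (f : MvPolynomial (Fin n) K) :
    piTilde t i (g * f) = g * piTilde t i f := by
  have e : simpleSwap i (g * f) = g * simpleSwap i f := by
    rw [simpleSwap, map_mul]; exact congrArg (· * _) hg
  refine mul_left_cancel₀ (X_pos_sub_X_posSucc_ne_zero i) ?_
  have h := mul_piTilde t i (g * f)
  rw [e] at h
  linear_combination h - g * mul_piTilde t i f

theorem thetaTilde_mul_of_simpleSwap_eq (t : K) (i : Fin (n - 1)) {g : MvPolynomial (Fin n) K}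
    (hg : simpleSwap i g = g) (f : MvPolynomial (Fin n) K) :
    thetaTilde t i (g * f) = g * thetaTilde t i f := by
  linear_combination piTilde_mul_of_simpleSwap_eq t i hg f - piTilde_eq_thetaTilde_add t i (g * f)
    + g * piTilde_eq_thetaTilde_add t i f

theorem piTilde_add (t : K) (i : Fin (n - 1)) (f g : MvPolynomial (Fin n) K) :
    piTilde t i (f + g) = piTilde t i f + piTilde t i g := by
  refine mul_left_cancel₀ (X_pos_sub_X_posSucc_ne_zero i) ?_
  have h := mul_piTilde t i (f + g)
  have e : simpleSwap i (f + g) = simpleSwap i f + simpleSwap i g := map_add _ _ _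
  rw [e] at h
  linear_combination h - mul_piTilde t i f - mul_piTilde t i g

theorem thetaTilde_add (t : K) (i : Fin (n - 1)) (f g : MvPolynomial (Fin n) K) :
    thetaTilde t i (f + g) = thetaTilde t i f + thetaTilde t i g := by
  linear_combination piTilde_add t i f g - piTilde_eq_thetaTilde_add t i (f + g)
    + piTilde_eq_thetaTilde_add t i f + piTilde_eq_thetaTilde_add t i g

theorem piTilde_one (t : K) (i : Fin (n - 1)) : piTilde t i 1 = 1 := by
  refine mul_left_cancel₀ (X_pos_sub_X_posSucc_ne_zero i) ?_
  have h := mul_piTilde t i 1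
  rw [simpleSwap, map_one] at h
  linear_combination h

theorem simpleSwap_simpleSwap (i : Fin (n - 1)) (f : MvPolynomial (Fin n) K) :
    simpleSwap i (simpleSwap i f) = f := by
  rw [simpleSwap, simpleSwap, MvPolynomial.rename_rename]
  convert MvPolynomial.rename_id_apply f using 3
  ext x
  simp

theorem thetaTilde_X_mul (t : K) (i : Fin (n - 1)) (f : MvPolynomial (Fin n) K) :
    thetaTilde t i (MvPolynomial.X (pos i) * f) = MvPolynomial.X (posSucc i) * piTilde t i f := by
  refine mul_left_cancel₀ (X_pos_sub_X_posSucc_ne_zero i) ?_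
  have h := mul_thetaTilde t i (MvPolynomial.X (pos i) * f)
  have e : simpleSwap i (MvPolynomial.X (pos i) * f) =
      MvPolynomial.X (posSucc i) * simpleSwap i f := by
    simp [simpleSwap]
  rw [e] at h
  linear_combination h - MvPolynomial.X (posSucc i) * mul_piTilde t i f

theorem piTilde_X_mul (t : K) (i : Fin (n - 1)) (f : MvPolynomial (Fin n) K) :
    piTilde t i (MvPolynomial.X (posSucc i) * f) =
      MvPolynomial.X (pos i) * thetaTilde t i f := by
  refine mul_left_cancel₀ (X_pos_sub_X_posSucc_ne_zero i) ?_
  have h := mul_piTilde t i (MvPolynomial.X (posSucc i) * f)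
  have e : simpleSwap i (MvPolynomial.X (posSucc i) * f) =
      MvPolynomial.X (pos i) * simpleSwap i f := by
    simp [simpleSwap]
  rw [e] at h
  linear_combination h - MvPolynomial.X (pos i) * mul_thetaTilde t i f

/-- The operators `θ̃_i` and `π̃_i` are inverse to each other up to the factor `t`; this is the
quadratic relation of the Hecke algebra. -/
theorem thetaTilde_piTilde (t : K) (i : Fin (n - 1)) (f : MvPolynomial (Fin n) K) :
    thetaTilde t i (piTilde t i f) = MvPolynomial.C t * f := by
  have hne := X_pos_sub_X_posSucc_ne_zero (K := K) i
  refine mul_left_cancel₀ hne (mul_left_cancel₀ hne ?_)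
  have h1 := mul_piTilde t i f
  have h2 := congrArg (simpleSwap i) h1
  have h3 := mul_thetaTilde t i (piTilde t i f)
  have e := simpleSwap_simpleSwap i f
  simp only [simpleSwap, map_mul, map_sub, map_add, map_one, MvPolynomial.rename_X,
    MvPolynomial.rename_C, Equiv.swap_apply_left, Equiv.swap_apply_right] at h1 h2 h3 e
  rw [e] at h2
  linear_combination (MvPolynomial.X (pos i) - MvPolynomial.X (posSucc i)) * h3 +
    (1 - MvPolynomial.C t) * MvPolynomial.X (posSucc i) * h1 -
    (MvPolynomial.C t * MvPolynomial.X (pos i) - MvPolynomial.X (posSucc i)) * h2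

theorem simpleSwap_C_mul_X (i : Fin (n - 1)) (c : K) {b : Fin n} (h1 : b ≠ pos i)
    (h2 : b ≠ posSucc i) :
    simpleSwap i (MvPolynomial.C c * MvPolynomial.X b) =
      (MvPolynomial.C c * MvPolynomial.X b : MvPolynomial (Fin n) K) := by
  simp [simpleSwap, Equiv.swap_apply_of_ne_of_ne h1 h2]

theorem simpleSwap_C (i : Fin (n - 1)) (c : K) :
    simpleSwap i (MvPolynomial.C c) = (MvPolynomial.C c : MvPolynomial (Fin n) K) := by
  simp [simpleSwap]

end OperatorRelations

/-! ### Queues of rows -/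

section Queues

variable {n : ℕ} {K : Type*} [Field K]

/-- The weight of replacing the label `a` of the first row of a queue by `b`, when `k` boxes of
that row remain to be filled after this one and `Q` is the rest of the queue: zero unless `b` is at
most `a` and not a label of `Q`. A row of `Q` with `j` boxes left contributes a coinversion when
`j ≤ k` and its label lies strictly between `b` and `a`. -/
noncomputable def stepWeight (t : K) (k : ℕ) (a b : Fin n) (Q : List (ℕ × Fin n)) : K :=
  if b ≤ a ∧ b ∉ Q.map Prod.snd then
    t ^ Q.countP (fun e => decide (e.1 ≤ k ∧ b < e.2 ∧ e.2 < a)) * (if a = b then 1 else 1 - t)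
  else 0

/-- The generating function of the ways to fill the remaining boxes of a queue. An entry `(k, a)` of
the queue is a row with `k` boxes left whose last entry so far is `a`. The first row of the queue is
filled by one box and moves to the end; it leaves the queue if it has no box left. -/
noncomputable def queueSum (t : K) : List (ℕ × Fin n) → MvPolynomial (Fin n) K
  | [] => 1
  | (0, _) :: Q => queueSum t Q
  | (k + 1, a) :: Q => ∑ b : Fin n,
      MvPolynomial.C (stepWeight t k a b Q) * MvPolynomial.X b * queueSum t (Q ++ [(k, b)])
termination_by Q => (Q.map fun e => e.1 + 1).sum
decreasing_by
  · simp
  · simp only [List.map_append, List.map_cons, List.map_nil, List.sum_append, List.sum_cons,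
      List.sum_nil]
    omega

theorem queueSum_nil (t : K) : queueSum t ([] : List (ℕ × Fin n)) = 1 := by
  rw [queueSum]

theorem queueSum_zero_cons (t : K) (a : Fin n) (Q : List (ℕ × Fin n)) :
    queueSum t ((0, a) :: Q) = queueSum t Q := by
  rw [queueSum]

theorem queueSum_succ_cons (t : K) (k : ℕ) (a : Fin n) (Q : List (ℕ × Fin n)) :
    queueSum t ((k + 1, a) :: Q) = ∑ b : Fin n,
      MvPolynomial.C (stepWeight t k a b Q) * MvPolynomial.X b * queueSum t (Q ++ [(k, b)]) := by
  rw [queueSum]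

/-- Induction along the filling of a queue. The labels of the shorter queue are arbitrary. -/
theorem queue_induction {P : List (ℕ × Fin n) → Prop} (nil : P [])
    (zero : ∀ a Q, P Q → P ((0, a) :: Q))
    (succ : ∀ k a Q, (∀ Q', Q'.map Prod.fst = Q.map Prod.fst ++ [k] → P Q') →
      P ((k + 1, a) :: Q)) (Q : List (ℕ × Fin n)) :
    P Q := by
  induction hN : (Q.map fun e => e.1 + 1).sum using Nat.strong_induction_on generalizing Q with
  | _ N ih =>
    subst hN
    match Q with
    | [] => exact nil
    | (0, a) :: Q => exact zero a Q (ih _ (by simp) Q rfl)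
    | (k + 1, a) :: Q =>
      refine succ k a Q fun Q' hQ' => ih _ ?_ Q' rfl
      have h (L : List (ℕ × Fin n)) :
          (L.map fun e => e.1 + 1) = (L.map Prod.fst).map (· + 1) := by simp
      rw [h, h, hQ']
      simp only [List.map_append, List.map_cons, List.map_nil, List.sum_append, List.sum_cons,
        List.sum_nil]
      omega

/-- Exchange the labels `i` and `i + 1` in a queue. -/
def swapLabels (i : Fin (n - 1)) (Q : List (ℕ × Fin n)) : List (ℕ × Fin n) :=
  Q.map (Prod.map id (Equiv.swap (pos i) (posSucc i)))

theorem swapLabels_cons (i : Fin (n - 1)) (k : ℕ) (a : Fin n) (Q : List (ℕ × Fin n)) :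
    swapLabels i ((k, a) :: Q) =
      (k, Equiv.swap (pos i) (posSucc i) a) :: swapLabels i Q := rfl

theorem swapLabels_concat (i : Fin (n - 1)) (Q : List (ℕ × Fin n)) (k : ℕ) (a : Fin n) :
    swapLabels i (Q ++ [(k, a)]) =
      swapLabels i Q ++ [(k, Equiv.swap (pos i) (posSucc i) a)] := by
  simp [swapLabels]

theorem swapLabels_swapLabels (i : Fin (n - 1)) (Q : List (ℕ × Fin n)) :
    swapLabels i (swapLabels i Q) = Q := by
  simp [swapLabels, Function.comp_def, Prod.map]

theorem map_snd_swapLabels (i : Fin (n - 1)) (Q : List (ℕ × Fin n)) :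
    (swapLabels i Q).map Prod.snd = (Q.map Prod.snd).map (Equiv.swap (pos i) (posSucc i)) := by
  simp [swapLabels, Function.comp_def]

theorem mem_labels_swapLabels (i : Fin (n - 1)) (Q : List (ℕ × Fin n)) (x : Fin n) :
    x ∈ (swapLabels i Q).map Prod.snd ↔
      Equiv.swap (pos i) (posSucc i) x ∈ Q.map Prod.snd := by
  rw [map_snd_swapLabels, List.mem_map]
  constructor
  · rintro ⟨y, hy, rfl⟩
    simpa using hy
  · exact fun h => ⟨_, h, by simp⟩

theorem nodup_swapLabels (i : Fin (n - 1)) {Q : List (ℕ × Fin n)} (h : (Q.map Prod.snd).Nodup) :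
    ((swapLabels i Q).map Prod.snd).Nodup := by
  rw [map_snd_swapLabels]
  exact h.map (Equiv.injective _)

theorem swapLabels_eq_self (i : Fin (n - 1)) {Q : List (ℕ × Fin n)}
    (h1 : pos i ∉ Q.map Prod.snd) (h2 : posSucc i ∉ Q.map Prod.snd) : swapLabels i Q = Q := by
  rw [swapLabels]
  conv_rhs => rw [← List.map_id Q]
  refine List.map_congr_left fun e he => ?_
  have he' := List.mem_map_of_mem (f := Prod.snd) he
  exact Prod.ext rfl (Equiv.swap_apply_of_ne_of_ne (fun h => h1 (h ▸ he')) fun h => h2 (h ▸ he'))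

theorem swap_cases (i : Fin (n - 1)) (x : Fin n) :
    (x = pos i ∧ Equiv.swap (pos i) (posSucc i) x = posSucc i) ∨
    (x = posSucc i ∧ Equiv.swap (pos i) (posSucc i) x = pos i) ∨
    ((x ≠ pos i ∧ x ≠ posSucc i) ∧ Equiv.swap (pos i) (posSucc i) x = x) := by
  by_cases h1 : x = pos i
  · exact Or.inl ⟨h1, by rw [h1, Equiv.swap_apply_left]⟩
  · by_cases h2 : x = posSucc i
    · exact Or.inr (Or.inl ⟨h2, by rw [h2, Equiv.swap_apply_right]⟩)
    · exact Or.inr (Or.inr ⟨⟨h1, h2⟩, Equiv.swap_apply_of_ne_of_ne h1 h2⟩)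

/-- Exchanging two adjacent labels only affects the comparison of these two labels. -/
theorem swap_lt_swap_iff (i : Fin (n - 1)) {x y : Fin n} (h1 : ¬(x = pos i ∧ y = posSucc i))
    (h2 : ¬(x = posSucc i ∧ y = pos i)) :
    Equiv.swap (pos i) (posSucc i) x < Equiv.swap (pos i) (posSucc i) y ↔ x < y := by
  rw [Fin.ext_iff, Fin.ext_iff] at h1 h2
  have hp : (pos i).val = i.val := rfl
  have hq : (posSucc i).val = i.val + 1 := rfl
  rw [Fin.lt_def, Fin.lt_def]
  rcases swap_cases i x with ⟨hx, hx'⟩ | ⟨hx, hx'⟩ | ⟨hx, hx'⟩ <;>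
    rcases swap_cases i y with ⟨hy, hy'⟩ | ⟨hy, hy'⟩ | ⟨hy, hy'⟩ <;>
    rw [hx', hy'] <;> simp only [ne_eq, Fin.ext_iff, hp, hq] at hx hy h1 h2 ⊢ <;> omega

theorem swap_le_swap_iff (i : Fin (n - 1)) {x y : Fin n} (h1 : ¬(x = pos i ∧ y = posSucc i))
    (h2 : ¬(x = posSucc i ∧ y = pos i)) :
    Equiv.swap (pos i) (posSucc i) x ≤ Equiv.swap (pos i) (posSucc i) y ↔ x ≤ y := by
  rw [← not_lt, ← not_lt, swap_lt_swap_iff i (fun h => h2 h.symm) fun h => h1 h.symm]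

theorem stepWeight_eq_zero_of_mem (t : K) (k : ℕ) (a : Fin n) {b : Fin n}
    {Q : List (ℕ × Fin n)} (h : b ∈ Q.map Prod.snd) : stepWeight t k a b Q = 0 :=
  if_neg fun h' => h'.2 h

theorem stepWeight_eq_zero_of_lt (t : K) (k : ℕ) {a b : Fin n} (Q : List (ℕ × Fin n))
    (h : a < b) : stepWeight t k a b Q = 0 :=
  if_neg fun h' => h.not_ge h'.1

theorem stepWeight_self (t : K) (k : ℕ) {a : Fin n} {Q : List (ℕ × Fin n)}
    (h : a ∉ Q.map Prod.snd) : stepWeight t k a a Q = 1 := by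
  rw [stepWeight, if_pos ⟨le_rfl, h⟩, if_pos rfl, mul_one]
  convert pow_zero t
  rw [List.countP_eq_zero]
  intro e _
  simp only [decide_eq_true_eq, not_and, not_lt]
  exact fun _ h => h.le

/-- Lowering the label of the first row from `i + 1` to `i` creates no coinversion. -/
theorem stepWeight_posSucc_pos (t : K) (k : ℕ) (i : Fin (n - 1)) {Q : List (ℕ × Fin n)}
    (h : pos i ∉ Q.map Prod.snd) : stepWeight t k (posSucc i) (pos i) Q = 1 - t := by
  rw [stepWeight, if_pos ⟨(pos_lt_posSucc i).le, h⟩, if_neg (pos_lt_posSucc i).ne']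
  convert one_mul (1 - t)
  convert pow_zero t
  rw [List.countP_eq_zero]
  intro e _
  simp only [decide_eq_true_eq, not_and, not_lt, Fin.lt_def, pos, posSucc]
  omega

theorem countP_swapLabels (i : Fin (n - 1)) (k : ℕ) (a b : Fin n) (Q : List (ℕ × Fin n)) :
    (swapLabels i Q).countP (fun e => decide (e.1 ≤ k ∧ b < e.2 ∧ e.2 < a)) =
      Q.countP (fun e => decide (e.1 ≤ k ∧ b < Equiv.swap (pos i) (posSucc i) e.2 ∧
        Equiv.swap (pos i) (posSucc i) e.2 < a)) := by
  rw [swapLabels, List.countP_map]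
  rfl

/-- Exchanging two adjacent labels preserves the weight of a step if none of the comparisons that
enter it is one of these two labels with the other. -/
theorem stepWeight_swap (t : K) (k : ℕ) (i : Fin (n - 1)) (a b : Fin n)
    (Q : List (ℕ × Fin n)) (h1 : ¬(b = pos i ∧ a = posSucc i)) (h2 : ¬(b = posSucc i ∧ a = pos i))
    (h : ∀ e ∈ Q, e.1 ≤ k →
      (¬(b = pos i ∧ e.2 = posSucc i) ∧ ¬(b = posSucc i ∧ e.2 = pos i)) ∧
      (¬(e.2 = pos i ∧ a = posSucc i) ∧ ¬(e.2 = posSucc i ∧ a = pos i))) :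
    stepWeight t k (Equiv.swap (pos i) (posSucc i) a) (Equiv.swap (pos i) (posSucc i) b)
      (swapLabels i Q) = stepWeight t k a b Q := by
  have hc : (swapLabels i Q).countP (fun e => decide (e.1 ≤ k ∧
        Equiv.swap (pos i) (posSucc i) b < e.2 ∧ e.2 < Equiv.swap (pos i) (posSucc i) a)) =
      Q.countP (fun e => decide (e.1 ≤ k ∧ b < e.2 ∧ e.2 < a)) := by
    rw [countP_swapLabels]
    refine List.countP_congr fun e he => ?_
    simp only [decide_eq_true_eq]
    refine and_congr_right fun hk => ?_
    obtain ⟨⟨h3, h4⟩, h5, h6⟩ := h e he hk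
    rw [swap_lt_swap_iff i h3 h4, swap_lt_swap_iff i h5 h6]
  simp only [stepWeight, hc, swap_le_swap_iff i h1 h2, mem_labels_swapLabels, Equiv.swap_apply_self,
    EmbeddingLike.apply_eq_iff_eq]

/-- If exactly one more entry of a queue with distinct labels is counted, the count increases
by one. -/
theorem countP_eq_succ {Q : List (ℕ × Fin n)} (hQ : (Q.map Prod.snd).Nodup) {e₀ : ℕ × Fin n}
    (he₀ : e₀ ∈ Q) {p p' : ℕ × Fin n → Bool} (hp : p e₀ = false) (hp' : p' e₀ = true)
    (h : ∀ e ∈ Q, e.2 ≠ e₀.2 → (p' e = true ↔ p e = true)) :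
    Q.countP p' = Q.countP p + 1 := by
  have hperm := List.perm_cons_erase he₀
  rw [hperm.countP_eq, hperm.countP_eq, List.countP_cons_of_pos hp',
    List.countP_cons_of_neg (by simp [hp])]
  congr 1
  refine List.countP_congr fun e he => h e (List.mem_of_mem_erase he) fun h2 => ?_
  have hn := (hperm.map Prod.snd).nodup_iff.1 hQ
  rw [List.map_cons, List.nodup_cons] at hn
  exact hn.1 (h2 ▸ List.mem_map_of_mem he)

/-- For a step from `a > i + 1` to `i`, the row with the label `i + 1` is a coinversion. After the
exchange of the labels, for a step to `i + 1`, this row has the label `i` and is none. -/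
theorem stepWeight_pos_of_gt (t : K) (k : ℕ) (i : Fin (n - 1)) {a : Fin n} (ha : posSucc i < a)
    {j : ℕ} (hj : j ≤ k) {Q : List (ℕ × Fin n)} (hQ : (Q.map Prod.snd).Nodup)
    (hjQ : (j, pos i) ∈ Q) (hi : posSucc i ∉ Q.map Prod.snd) :
    stepWeight t k a (pos i) (swapLabels i Q) = t * stepWeight t k a (posSucc i) Q := by
  have hlt := pos_lt_posSucc i
  have hc : (swapLabels i Q).countP (fun e => decide (e.1 ≤ k ∧ pos i < e.2 ∧ e.2 < a)) =
      Q.countP (fun e => decide (e.1 ≤ k ∧ posSucc i < e.2 ∧ e.2 < a)) + 1 := by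
    rw [countP_swapLabels]
    refine countP_eq_succ hQ hjQ ?_ ?_ fun e he hne => ?_
    · simp [hlt.not_gt]
    · simp [hj, hlt, ha]
    · have hne' : e.2 ≠ posSucc i := fun h' => hi (h' ▸ List.mem_map_of_mem he)
      simp only [Equiv.swap_apply_of_ne_of_ne hne hne', decide_eq_true_eq]
      have : pos i < e.2 ↔ posSucc i < e.2 := by
        simp only [ne_eq, Fin.ext_iff, Fin.lt_def, pos, posSucc] at hne hne' ⊢
        omega
      rw [this]
  have h1 : pos i ∉ (swapLabels i Q).map Prod.snd := by
    rwa [mem_labels_swapLabels, Equiv.swap_apply_left]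
  have h2 : a ≠ pos i := (hlt.trans ha).ne'
  simp only [stepWeight, hc, (hlt.trans ha).le, h1, ha.le, hi, h2, ha.ne', not_false_eq_true,
    and_self, if_true, if_false]
  ring

/-- For a step from `i + 1` to a label below `i`, the row with the label `i` is a coinversion. After
the exchange of the labels, for a step from `i`, this row has the label `i + 1` and is none. -/
theorem stepWeight_posSucc_of_lt (t : K) (k : ℕ) (i : Fin (n - 1)) {b : Fin n} (hb : b ≠ pos i)
    (hb' : b ≠ posSucc i) {j : ℕ} (hj : j ≤ k) {Q : List (ℕ × Fin n)}
    (hQ : (Q.map Prod.snd).Nodup)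
    (hjQ : (j, posSucc i) ∈ Q) (hi : pos i ∉ Q.map Prod.snd) :
    stepWeight t k (posSucc i) b (swapLabels i Q) = t * stepWeight t k (pos i) b Q := by
  have hlt := pos_lt_posSucc i
  have hle : b ≤ posSucc i ↔ b ≤ pos i := by
    simp only [ne_eq, Fin.ext_iff, Fin.le_def, pos, posSucc] at hb hb' ⊢
    omega
  by_cases hbi : b ≤ pos i
  · have hc : (swapLabels i Q).countP (fun e => decide (e.1 ≤ k ∧ b < e.2 ∧ e.2 < posSucc i)) =
        Q.countP (fun e => decide (e.1 ≤ k ∧ b < e.2 ∧ e.2 < pos i)) + 1 := by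
      rw [countP_swapLabels]
      refine countP_eq_succ hQ hjQ ?_ ?_ fun e he hne => ?_
      · simp [hlt.not_gt]
      · simp [hj, hlt, lt_of_le_of_ne hbi hb]
      · have hne' : e.2 ≠ pos i := fun h' => hi (h' ▸ List.mem_map_of_mem he)
        simp only [Equiv.swap_apply_of_ne_of_ne hne' hne, decide_eq_true_eq]
        have : e.2 < posSucc i ↔ e.2 < pos i := by
          simp only [ne_eq, Fin.ext_iff, Fin.lt_def, pos, posSucc] at hne hne' ⊢
          omega
        rw [this]
    simp only [stepWeight, hc, mem_labels_swapLabels, Equiv.swap_apply_of_ne_of_ne hb hb',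
      hle, hb.symm, hb'.symm, if_false]
    split_ifs <;> ring
  · rw [stepWeight_eq_zero_of_lt _ _ _ (not_le.1 hbi),
      stepWeight_eq_zero_of_lt _ _ _ (not_le.1 fun h => hbi (hle.1 h)), mul_zero]

end Queues

/-! ### Demazure–Lusztig operators acting on queues -/

section Intertwining

variable {n : ℕ} {K : Type*} [Field K]

/-- The queues on which exchanging the labels `i` and `i + 1` is the operator `π̃_i`: either
`i + 1` is not a label, or `i + 1` comes before `i`, with at most as many boxes left. -/
def PiCond (i : Fin (n - 1)) (Q : List (ℕ × Fin n)) : Prop :=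
  posSucc i ∉ Q.map Prod.snd ∨
    ∃ j k, k ≤ j ∧ List.Sublist [(k, posSucc i), (j, pos i)] Q

/-- The queues on which exchanging the labels `i` and `i + 1` is the operator `θ̃_i`: the label `i`
comes before `i + 1`, with strictly more boxes left. -/
def ThetaCond (i : Fin (n - 1)) (Q : List (ℕ × Fin n)) : Prop :=
  ∃ j k, k < j ∧ List.Sublist [(j, pos i), (k, posSucc i)] Q

theorem sum_eq_pos_add_posSucc_add {M : Type*} [AddCommMonoid M] (i : Fin (n - 1))
    (f : Fin n → M) :
    ∑ b, f b = (f (pos i) + f (posSucc i)) + ∑ b ∈ Finset.univ \ {pos i, posSucc i}, f b := by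
  rw [← Finset.sum_sdiff (Finset.subset_univ {pos i, posSucc i}), add_comm,
    Finset.sum_pair (pos_lt_posSucc i).ne]

/-- An additive operator intertwines the exchange of the labels `i` and `i + 1` if it does so for
every choice of the next entry outside `{i, i + 1}`, and for the two choices `i`, `i + 1`
together. -/
theorem queueSum_swapLabels_succ_cons (t : K) (i : Fin (n - 1))
    (ρ : MvPolynomial (Fin n) K → MvPolynomial (Fin n) K) (hρ : ∀ f g, ρ (f + g) = ρ f + ρ g)
    (k : ℕ) (a a' : Fin n) (Q : List (ℕ × Fin n))
    (ha : Equiv.swap (pos i) (posSucc i) a = a')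
    (h1 : ∀ b, b ≠ pos i → b ≠ posSucc i →
      MvPolynomial.C (stepWeight t k a' b (swapLabels i Q)) *
          MvPolynomial.X b * queueSum t (swapLabels i (Q ++ [(k, b)])) =
        ρ (MvPolynomial.C (stepWeight t k a b Q) * MvPolynomial.X b * queueSum t (Q ++ [(k, b)])))
    (h2 : MvPolynomial.C (stepWeight t k a' (pos i) (swapLabels i Q)) *
          MvPolynomial.X (pos i) * queueSum t (swapLabels i (Q ++ [(k, posSucc i)])) +
        MvPolynomial.C (stepWeight t k a' (posSucc i) (swapLabels i Q)) *
          MvPolynomial.X (posSucc i) * queueSum t (swapLabels i (Q ++ [(k, pos i)])) =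
      ρ (MvPolynomial.C (stepWeight t k a (pos i) Q) * MvPolynomial.X (pos i) *
          queueSum t (Q ++ [(k, pos i)]) +
        MvPolynomial.C (stepWeight t k a (posSucc i) Q) * MvPolynomial.X (posSucc i) *
          queueSum t (Q ++ [(k, posSucc i)]))) :
    queueSum t (swapLabels i ((k + 1, a) :: Q)) = ρ (queueSum t ((k + 1, a) :: Q)) := by
  rw [swapLabels_cons, queueSum_succ_cons, queueSum_succ_cons, sum_eq_pos_add_posSucc_add i,
    sum_eq_pos_add_posSucc_add i, hρ, ha, ← h2]
  have hs := map_sum (AddMonoidHom.mk' ρ hρ) (fun b => MvPolynomial.C (stepWeight t k a b Q) *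
    MvPolynomial.X b * queueSum t (Q ++ [(k, b)])) (Finset.univ \ {pos i, posSucc i})
  simp only [AddMonoidHom.mk'_apply] at hs
  rw [hs, swapLabels_concat, swapLabels_concat, Equiv.swap_apply_left, Equiv.swap_apply_right]
  congr 1
  refine Finset.sum_congr rfl fun b hb => ?_
  simp only [Finset.mem_sdiff, Finset.mem_univ, true_and, Finset.mem_insert,
    Finset.mem_singleton, not_or] at hb
  rw [← h1 b hb.1 hb.2, swapLabels_concat, Equiv.swap_apply_of_ne_of_ne hb.1 hb.2]

theorem nodup_concat {Q : List (ℕ × Fin n)} (hQ : (Q.map Prod.snd).Nodup) (k : ℕ) {b : Fin n}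
    (hb : b ∉ Q.map Prod.snd) : ((Q ++ [(k, b)]).map Prod.snd).Nodup := by
  rw [List.map_append, List.nodup_append]
  refine ⟨hQ, by simp, fun x hx y hy => ?_⟩
  simp only [List.map_cons, List.map_nil, List.mem_singleton] at hy
  rintro rfl
  exact hb (hy ▸ hx)

theorem notMem_concat {Q : List (ℕ × Fin n)} {k : ℕ} {b x : Fin n} (hx : x ∉ Q.map Prod.snd)
    (hb : b ≠ x) : x ∉ (Q ++ [(k, b)]).map Prod.snd := by
  rw [List.map_append, List.mem_append]
  simp only [List.map_cons, List.map_nil, List.mem_singleton, not_or]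
  exact ⟨hx, hb.symm⟩

theorem exists_of_mem_labels {Q : List (ℕ × Fin n)} {x : Fin n} (hx : x ∈ Q.map Prod.snd) :
    ∃ j, (j, x) ∈ Q := by
  obtain ⟨⟨j, y⟩, hy, rfl⟩ := List.mem_map.1 hx
  exact ⟨j, hy⟩

theorem sublist_concat {Q : List (ℕ × Fin n)} {e : ℕ × Fin n} (he : e ∈ Q) (e' : ℕ × Fin n) :
    List.Sublist [e, e'] (Q ++ [e']) :=
  (List.singleton_sublist.2 he).append (List.Sublist.refl [e'])

theorem sublist_pair_cons {Q : List (ℕ × Fin n)} {e e' x : ℕ × Fin n}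
    (h : List.Sublist [e, e'] (x :: Q)) : List.Sublist [e, e'] Q ∨ (e = x ∧ e' ∈ Q) := by
  cases h with
  | cons _ h => exact Or.inl h
  | cons_cons _ h => exact Or.inr ⟨rfl, List.singleton_sublist.1 h⟩

theorem piCond_swapLabels_concat (i : Fin (n - 1)) {Q : List (ℕ × Fin n)} {j k : ℕ} (hjk : j ≤ k)
    (hj : (j, pos i) ∈ Q) : PiCond i (swapLabels i (Q ++ [(k, posSucc i)])) := by
  refine Or.inr ⟨k, j, hjk, ?_⟩
  have h := (sublist_concat hj (k, posSucc i)).map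
    (Prod.map id (Equiv.swap (pos i) (posSucc i)))
  simpa [swapLabels] using h

theorem eq_of_mem_labels {Q : List (ℕ × Fin n)} (hQ : (Q.map Prod.snd).Nodup)
    {e e' : ℕ × Fin n} (hj : e ∈ Q) (hk : e' ∈ Q) (h : e.2 = e'.2) : e = e' :=
  List.inj_on_of_nodup_map hQ hj hk h

theorem piTilde_C_mul_X_mul (t : K) (i : Fin (n - 1)) (c : K) {b : Fin n} (h1 : b ≠ pos i)
    (h2 : b ≠ posSucc i) (f : MvPolynomial (Fin n) K) :
    piTilde t i (MvPolynomial.C c * MvPolynomial.X b * f) =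
      MvPolynomial.C c * MvPolynomial.X b * piTilde t i f :=
  piTilde_mul_of_simpleSwap_eq t i (simpleSwap_C_mul_X i c h1 h2) f

theorem thetaTilde_C_mul_X_mul (t : K) (i : Fin (n - 1)) (c : K) {b : Fin n} (h1 : b ≠ pos i)
    (h2 : b ≠ posSucc i) (f : MvPolynomial (Fin n) K) :
    thetaTilde t i (MvPolynomial.C c * MvPolynomial.X b * f) =
      MvPolynomial.C c * MvPolynomial.X b * thetaTilde t i f :=
  thetaTilde_mul_of_simpleSwap_eq t i (simpleSwap_C_mul_X i c h1 h2) f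

theorem piTilde_zero (t : K) (i : Fin (n - 1)) :
    piTilde t i (0 : MvPolynomial (Fin n) K) = 0 := by
  simpa using piTilde_add t i 0 0

theorem thetaTilde_zero (t : K) (i : Fin (n - 1)) :
    thetaTilde t i (0 : MvPolynomial (Fin n) K) = 0 := by
  simpa using thetaTilde_add t i 0 0

theorem piTilde_C_mul (t : K) (i : Fin (n - 1)) (c : K) (f : MvPolynomial (Fin n) K) :
    piTilde t i (MvPolynomial.C c * f) = MvPolynomial.C c * piTilde t i f :=
  piTilde_mul_of_simpleSwap_eq t i (simpleSwap_C i c) f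

theorem PiCond.of_zero_cons {i : Fin (n - 1)} {a : Fin n} {Q : List (ℕ × Fin n)}
    (hQ : (((0, a) :: Q).map Prod.snd).Nodup) (h : PiCond i ((0, a) :: Q)) : PiCond i Q := by
  rcases h with h | ⟨j, k, hk, hs⟩
  · exact Or.inl fun h' => h (List.mem_cons_of_mem _ h')
  · cases hs with
    | cons _ h => exact Or.inr ⟨j, k, hk, h⟩
    | cons_cons _ h => exact Or.inl (List.nodup_cons.1 hQ).1

theorem ThetaCond.of_zero_cons {i : Fin (n - 1)} {a : Fin n} {Q : List (ℕ × Fin n)}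
    (h : ThetaCond i ((0, a) :: Q)) : ThetaCond i Q := by
  obtain ⟨j, k, hk, hs⟩ := h
  cases hs with
  | cons _ h => exact ⟨j, k, hk, h⟩
  | cons_cons _ h => exact absurd hk (Nat.not_lt_zero _)

theorem PiCond.rotate {i : Fin (n - 1)} {k : ℕ} {a b : Fin n} {Q : List (ℕ × Fin n)}
    (ha : a ≠ posSucc i) (hb : b ≠ posSucc i) (h : PiCond i ((k + 1, a) :: Q)) :
    PiCond i (Q ++ [(k, b)]) := by
  rcases h with h | ⟨j, k, hk, hs⟩
  · exact Or.inl (notMem_concat (fun h' => h (List.mem_cons_of_mem _ h')) hb)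
  · cases hs with
    | cons _ h => exact Or.inr ⟨j, k, hk, h.trans (List.sublist_append_left _ _)⟩
    | cons_cons _ h => exact absurd rfl ha

theorem ThetaCond.rotate {i : Fin (n - 1)} {k : ℕ} {a b : Fin n} {Q : List (ℕ × Fin n)}
    (ha : a ≠ pos i) (h : ThetaCond i ((k + 1, a) :: Q)) :
    ThetaCond i (Q ++ [(k, b)]) := by
  obtain ⟨j, k, hk, hs⟩ := h
  cases hs with
  | cons _ h => exact ⟨j, k, hk, h.trans (List.sublist_append_left _ _)⟩
  | cons_cons _ h => exact absurd rfl ha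

theorem mem_labels_of_mem {Q : List (ℕ × Fin n)} {e : ℕ × Fin n} (he : e ∈ Q) :
    e.2 ∈ Q.map Prod.snd := List.mem_map_of_mem he

theorem mem_of_sublist_pair {Q : List (ℕ × Fin n)} {e e' : ℕ × Fin n}
    (h : List.Sublist [e, e'] Q) : e ∈ Q ∧ e' ∈ Q :=
  ⟨h.subset (by simp), h.subset (by simp)⟩

/-- The two choices `i`, `i + 1` of a new entry, when neither of them is a label of the queue. They
have the same weight, and `x_i f + x_{i+1} π̃_i f` is fixed by `π̃_i`. -/
theorem pair_of_notMem (t : K) (i : Fin (n - 1)) (k : ℕ) {a : Fin n} (ha1 : a ≠ pos i)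
    (ha2 : a ≠ posSucc i) {Q : List (ℕ × Fin n)}
    (hp : pos i ∉ Q.map Prod.snd) (hq : posSucc i ∉ Q.map Prod.snd)
    (ih : queueSum t (swapLabels i (Q ++ [(k, pos i)])) =
      piTilde t i (queueSum t (Q ++ [(k, pos i)]))) :
    MvPolynomial.C (stepWeight t k a (pos i) (swapLabels i Q)) *
          MvPolynomial.X (pos i) * queueSum t (swapLabels i (Q ++ [(k, posSucc i)])) +
        MvPolynomial.C (stepWeight t k a (posSucc i) (swapLabels i Q)) *
          MvPolynomial.X (posSucc i) * queueSum t (swapLabels i (Q ++ [(k, pos i)])) =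
      piTilde t i (MvPolynomial.C (stepWeight t k a (pos i) Q) * MvPolynomial.X (pos i) *
          queueSum t (Q ++ [(k, pos i)]) +
        MvPolynomial.C (stepWeight t k a (posSucc i) Q) * MvPolynomial.X (posSucc i) *
          queueSum t (Q ++ [(k, posSucc i)])) := by
  have hs := swapLabels_eq_self i hp hq
  have hw : stepWeight t k a (posSucc i) Q = stepWeight t k a (pos i) Q := by
    have h := stepWeight_swap t k i a (pos i) Q (fun h => ha2 h.2)
      (fun h => (pos_lt_posSucc i).ne h.1) fun e he _ => by
        have h1 : e.2 ≠ pos i := fun h => hp (h ▸ mem_labels_of_mem he)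
        have h2 : e.2 ≠ posSucc i := fun h => hq (h ▸ mem_labels_of_mem he)
        simp [h1, h2]
    rwa [hs, Equiv.swap_apply_left, Equiv.swap_apply_of_ne_of_ne ha1 ha2] at h
  rw [swapLabels_concat, hs, Equiv.swap_apply_left] at ih
  rw [swapLabels_concat, swapLabels_concat, hs, Equiv.swap_apply_left, Equiv.swap_apply_right,
    hw, ih, mul_assoc, mul_assoc, ← mul_add, piTilde_C_mul,
    piTilde_add, piTilde_X_mul, thetaTilde_piTilde, piTilde_eq_thetaTilde_add t i (_ * _),
    thetaTilde_X_mul]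
  ring

/-- The two choices `i`, `i + 1` of a new entry, when only `i` is a label of the queue: only `i + 1`
is available, and only `i` after the exchange of the labels. -/
theorem pair_of_mem (t : K) (i : Fin (n - 1)) (k : ℕ) {a : Fin n} (ha1 : a ≠ pos i)
    (ha2 : a ≠ posSucc i) {Q : List (ℕ × Fin n)} (hQ : (Q.map Prod.snd).Nodup) {j : ℕ}
    (hj : (j, pos i) ∈ Q) (hq : posSucc i ∉ Q.map Prod.snd)
    (ih : k < j → queueSum t (swapLabels i (Q ++ [(k, posSucc i)])) =
      thetaTilde t i (queueSum t (Q ++ [(k, posSucc i)])))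
    (ih' : j ≤ k → queueSum t (Q ++ [(k, posSucc i)]) =
      piTilde t i (queueSum t (swapLabels i (Q ++ [(k, posSucc i)])))) :
    MvPolynomial.C (stepWeight t k a (pos i) (swapLabels i Q)) *
          MvPolynomial.X (pos i) * queueSum t (swapLabels i (Q ++ [(k, posSucc i)])) +
        MvPolynomial.C (stepWeight t k a (posSucc i) (swapLabels i Q)) *
          MvPolynomial.X (posSucc i) * queueSum t (swapLabels i (Q ++ [(k, pos i)])) =
      piTilde t i (MvPolynomial.C (stepWeight t k a (pos i) Q) * MvPolynomial.X (pos i) *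
          queueSum t (Q ++ [(k, pos i)]) +
        MvPolynomial.C (stepWeight t k a (posSucc i) Q) * MvPolynomial.X (posSucc i) *
          queueSum t (Q ++ [(k, posSucc i)])) := by
  have hp := mem_labels_of_mem hj
  rw [stepWeight_eq_zero_of_mem t k a hp, stepWeight_eq_zero_of_mem t k a
    (b := posSucc i) (Q := swapLabels i Q)
    (by rwa [mem_labels_swapLabels, Equiv.swap_apply_right])]
  simp only [map_zero, zero_mul, zero_add, add_zero]
  rw [mul_assoc, mul_assoc, piTilde_C_mul, piTilde_X_mul]
  rcases lt_or_gt_of_ne ha2 with ha | ha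
  · have ha' : a < pos i := by
      simp only [ne_eq, Fin.ext_iff, Fin.lt_def, pos, posSucc] at ha1 ha ⊢
      omega
    rw [stepWeight_eq_zero_of_lt _ _ _ ha, stepWeight_eq_zero_of_lt _ _ _ ha', map_zero,
      zero_mul, zero_mul]
  rcases le_or_gt j k with hjk | hjk
  · rw [stepWeight_pos_of_gt t k i ha hjk hQ hj hq, ih' hjk, thetaTilde_piTilde, map_mul]
    ring
  · rw [ih hjk]
    have h := stepWeight_swap t k i a (posSucc i) Q (fun h => ha2 h.2) (fun h => ha1 h.2)
      fun e he hk => by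
        have h1 : e.2 ≠ pos i := fun h => by
          rw [eq_of_mem_labels hQ he hj h] at hk
          exact absurd hk hjk.not_ge
        simp [h1, ha1, ha2, (pos_lt_posSucc i).ne']
    rw [Equiv.swap_apply_right, Equiv.swap_apply_of_ne_of_ne ha1 ha2] at h
    rw [h]

theorem stepWeight_swapLabels (t : K) (k : ℕ) (i : Fin (n - 1)) {a b : Fin n} (ha1 : a ≠ pos i)
    (ha2 : a ≠ posSucc i) (hb1 : b ≠ pos i) (hb2 : b ≠ posSucc i) (Q : List (ℕ × Fin n)) :
    stepWeight t k a b (swapLabels i Q) = stepWeight t k a b Q := by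
  have h := stepWeight_swap t k i a b Q (fun h => hb1 h.1) (fun h => hb2 h.1)
    fun e _ _ => by simp [ha1, ha2, hb1, hb2]
  rwa [Equiv.swap_apply_of_ne_of_ne ha1 ha2, Equiv.swap_apply_of_ne_of_ne hb1 hb2] at h

/-- Exchanging the labels `i` and `i + 1` of a queue is one of the operators `π̃_i`, `θ̃_i`,
depending on the relative positions and lengths of the two rows. -/
theorem queueSum_swapLabels (t : K) (i : Fin (n - 1)) (Q : List (ℕ × Fin n)) :
    (Q.map Prod.snd).Nodup →
      (PiCond i Q → queueSum t (swapLabels i Q) = piTilde t i (queueSum t Q)) ∧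
      (ThetaCond i Q → queueSum t (swapLabels i Q) = thetaTilde t i (queueSum t Q)) := by
  induction Q using queue_induction with
  | nil =>
    refine fun _ => ⟨fun _ => ?_, fun ⟨_, _, _, h⟩ => by simp at h⟩
    rw [swapLabels, List.map_nil, queueSum_nil, piTilde_one]
  | zero a Q ih =>
    intro hQ
    have hQ' : (Q.map Prod.snd).Nodup := (List.nodup_cons.1 hQ).2
    rw [swapLabels_cons, queueSum_zero_cons, queueSum_zero_cons]
    exact ⟨fun h => (ih hQ').1 (h.of_zero_cons hQ), fun h => (ih hQ').2 h.of_zero_cons⟩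
  | succ k a Q ih' =>
    intro hQ
    have ih := fun b => ih' (Q ++ [(k, b)]) (by simp)
    have ihs := fun b => ih' (swapLabels i (Q ++ [(k, b)])) (by simp [swapLabels])
    have hQ' : (Q.map Prod.snd).Nodup := (List.nodup_cons.1 hQ).2
    have haQ : a ∉ Q.map Prod.snd := (List.nodup_cons.1 hQ).1
    have hlt := pos_lt_posSucc i
    -- A new entry that is already a label of `Q` has weight zero before and after the exchange.
    have hmem : ∀ a' b, b ≠ pos i → b ≠ posSucc i → b ∈ Q.map Prod.snd →
        stepWeight t k a b Q = 0 ∧ stepWeight t k a' b (swapLabels i Q) = 0 := fun a' b h1 h2 hb =>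
      ⟨stepWeight_eq_zero_of_mem _ _ _ hb, stepWeight_eq_zero_of_mem _ _ _ <| by
        rwa [mem_labels_swapLabels, Equiv.swap_apply_of_ne_of_ne h1 h2]⟩
    rcases swap_cases i a with ⟨rfl, ha⟩ | ⟨rfl, ha⟩ | ⟨⟨ha1, ha2⟩, ha⟩
    · -- The first row has the label `i`.
      constructor
      · intro h
        have hq : posSucc i ∉ Q.map Prod.snd := by
          rcases h with h | ⟨j, k', _, hs⟩
          · exact fun h' => h (List.mem_cons_of_mem _ h')
          · rcases sublist_pair_cons hs with h | ⟨h1, h2⟩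
            · exact absurd (mem_labels_of_mem (mem_of_sublist_pair h).2) haQ
            · exact fun _ => hlt.ne' (congrArg Prod.snd h1)
        have hsQ := swapLabels_eq_self i haQ hq
        refine queueSum_swapLabels_succ_cons t i _ (piTilde_add t i) k _ _ Q ha
          (fun b hb1 hb2 => ?_) ?_
        · by_cases hb : b ∈ Q.map Prod.snd
          · rw [(hmem (posSucc i) b hb1 hb2 hb).1, (hmem (posSucc i) b hb1 hb2 hb).2]
            simp [piTilde_zero]
          · have hw := stepWeight_swap t k i (pos i) b Q (fun h => hb1 h.1) (fun h => hb2 h.1)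
              fun e he _ => by
                have h2 : e.2 ≠ posSucc i := fun h => hq (h ▸ mem_labels_of_mem he)
                simp [hb1, hb2, h2, hlt.ne]
            rw [ha, Equiv.swap_apply_of_ne_of_ne hb1 hb2] at hw
            rw [hw, (ih b (nodup_concat hQ' k hb)).1 (Or.inl (notMem_concat hq hb2)),
              piTilde_C_mul_X_mul t i _ hb1 hb2]
        · have h0 := (ih (pos i) (nodup_concat hQ' k haQ)).1
            (Or.inl (notMem_concat hq hlt.ne))
          rw [swapLabels_concat, hsQ, Equiv.swap_apply_left] at h0
          rw [swapLabels_concat, swapLabels_concat, hsQ, Equiv.swap_apply_left,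
            Equiv.swap_apply_right, stepWeight_posSucc_pos t k i haQ, stepWeight_self t k hq,
            stepWeight_self t k haQ, stepWeight_eq_zero_of_lt t k Q hlt, h0]
          simp only [map_one, map_zero, one_mul, zero_mul, add_zero, map_sub]
          rw [piTilde_eq_thetaTilde_add t i (_ * _), thetaTilde_X_mul]
          ring
      · rintro ⟨j, r, hjr, hs⟩
        have hrj : j = k + 1 ∧ (r, posSucc i) ∈ Q := by
          rcases sublist_pair_cons hs with h | ⟨h1, h2⟩
          · exact absurd (mem_labels_of_mem (mem_of_sublist_pair h).1) haQ
          · exact ⟨congrArg Prod.fst h1, h2⟩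
        obtain ⟨rfl, hrQ⟩ := hrj
        have hr : r ≤ k := Nat.lt_succ_iff.1 hjr
        have hq := mem_labels_of_mem hrQ
        have hq' : posSucc i ∉ (swapLabels i Q).map Prod.snd := by
          rwa [mem_labels_swapLabels, Equiv.swap_apply_right]
        have hp' : pos i ∈ (swapLabels i Q).map Prod.snd := by
          rwa [mem_labels_swapLabels, Equiv.swap_apply_left]
        refine queueSum_swapLabels_succ_cons t i _ (thetaTilde_add t i) k _ _ Q ha
          (fun b hb1 hb2 => ?_) ?_
        · by_cases hb : b ∈ Q.map Prod.snd
          · rw [(hmem (posSucc i) b hb1 hb2 hb).1, (hmem (posSucc i) b hb1 hb2 hb).2]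
            simp [thetaTilde_zero]
          · -- Now `i + 1` is the only label left of the two, and `θ̃_i` undoes `π̃_i` up to `t`.
            have hn := nodup_concat hQ' k hb
            have h0 := (ihs b (nodup_swapLabels i hn)).1 <| Or.inl <| by
              rw [mem_labels_swapLabels, Equiv.swap_apply_right]
              exact notMem_concat haQ hb1
            rw [swapLabels_swapLabels] at h0
            rw [stepWeight_posSucc_of_lt t k i hb1 hb2 hr hQ' hrQ haQ,
              thetaTilde_C_mul_X_mul t i _ hb1 hb2, h0, thetaTilde_piTilde, map_mul]
            ring
        · have h0 := (ih (pos i) (nodup_concat hQ' k haQ)).1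
            (Or.inr ⟨k, r, hr, sublist_concat hrQ _⟩)
          rw [swapLabels_concat, Equiv.swap_apply_left] at h0
          rw [swapLabels_concat, swapLabels_concat, Equiv.swap_apply_left,
            Equiv.swap_apply_right, stepWeight_eq_zero_of_mem t k _ hp', stepWeight_self t k hq',
            stepWeight_self t k haQ, stepWeight_eq_zero_of_mem t k _ hq, h0]
          simp only [map_one, map_zero, one_mul, zero_mul, add_zero, zero_add]
          rw [thetaTilde_X_mul]
    · -- The first row has the label `i + 1`.
      constructor
      · intro h
        obtain ⟨j, hkj, hjQ⟩ : ∃ j, k < j ∧ (j, pos i) ∈ Q := by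
          rcases h with h | ⟨j, k', hk, hs⟩
          · exact absurd List.mem_cons_self h
          · rcases sublist_pair_cons hs with h | ⟨h1, h2⟩
            · exact absurd (mem_labels_of_mem (mem_of_sublist_pair h).1) haQ
            · exact ⟨j, Nat.lt_of_succ_le (le_of_eq_of_le (congrArg Prod.fst h1).symm hk), h2⟩
        have hp := mem_labels_of_mem hjQ
        have hp' : pos i ∉ (swapLabels i Q).map Prod.snd := by
          rwa [mem_labels_swapLabels, Equiv.swap_apply_left]
        refine queueSum_swapLabels_succ_cons t i _ (piTilde_add t i) k _ _ Q ha
          (fun b hb1 hb2 => ?_) ?_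
        · by_cases hb : b ∈ Q.map Prod.snd
          · rw [(hmem (pos i) b hb1 hb2 hb).1, (hmem (pos i) b hb1 hb2 hb).2]
            simp [piTilde_zero]
          · have hw := stepWeight_swap t k i (posSucc i) b Q (fun h => hb1 h.1)
              (fun h => hb2 h.1) fun e he hk => by
                have h2 : e.2 ≠ pos i := fun h => by
                  rw [eq_of_mem_labels hQ' he hjQ h] at hk
                  exact absurd hk hkj.not_ge
                simp [hb1, hb2, h2, hlt.ne']
            rw [ha, Equiv.swap_apply_of_ne_of_ne hb1 hb2] at hw
            rw [hw, (ih b (nodup_concat hQ' k hb)).1 (Or.inl (notMem_concat haQ hb2)),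
              piTilde_C_mul_X_mul t i _ hb1 hb2]
        · have h0 := (ih (posSucc i) (nodup_concat hQ' k haQ)).2
            ⟨j, k, hkj, sublist_concat hjQ _⟩
          rw [h0, stepWeight_eq_zero_of_mem t k _ hp, stepWeight_self t k hp',
            stepWeight_self t k haQ, stepWeight_eq_zero_of_lt t k _ hlt]
          simp only [map_one, map_zero, one_mul, zero_mul, add_zero, zero_add]
          rw [piTilde_X_mul]
      · rintro ⟨j, r, hjr, hs⟩
        rcases sublist_pair_cons hs with h | ⟨h1, h2⟩
        · exact absurd (mem_labels_of_mem (mem_of_sublist_pair h).2) haQ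
        · exact absurd (congrArg Prod.snd h1) hlt.ne
    · -- The first row has another label.
      have hw := fun b hb1 hb2 => stepWeight_swapLabels t k i ha1 ha2 (b := b) hb1 hb2 Q
      have hboth : pos i ∈ Q.map Prod.snd → posSucc i ∈ Q.map Prod.snd → ∀ b,
          b = pos i ∨ b = posSucc i →
          stepWeight t k a b Q = 0 ∧ stepWeight t k a b (swapLabels i Q) = 0 := by
        rintro hp hq b (rfl | rfl)
        · exact ⟨stepWeight_eq_zero_of_mem _ _ _ hp, stepWeight_eq_zero_of_mem _ _ _ <| by
            rwa [mem_labels_swapLabels, Equiv.swap_apply_left]⟩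
        · exact ⟨stepWeight_eq_zero_of_mem _ _ _ hq, stepWeight_eq_zero_of_mem _ _ _ <| by
            rwa [mem_labels_swapLabels, Equiv.swap_apply_right]⟩
      constructor
      · intro h
        refine queueSum_swapLabels_succ_cons t i _ (piTilde_add t i) k _ _ Q ha
          (fun b hb1 hb2 => ?_) ?_
        · by_cases hb : b ∈ Q.map Prod.snd
          · rw [(hmem a b hb1 hb2 hb).1, (hmem a b hb1 hb2 hb).2]
            simp [piTilde_zero]
          · rw [hw b hb1 hb2, (ih b (nodup_concat hQ' k hb)).1 (h.rotate ha2 hb2),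
              piTilde_C_mul_X_mul t i _ hb1 hb2]
        · by_cases hq : posSucc i ∈ Q.map Prod.snd
          · have hp : pos i ∈ Q.map Prod.snd := by
              rcases h with h | ⟨j, k', hk, hs⟩
              · exact absurd (List.mem_cons_of_mem _ hq) h
              · rcases sublist_pair_cons hs with h | ⟨h1, h2⟩
                · exact mem_labels_of_mem (mem_of_sublist_pair h).2
                · exact absurd (congrArg Prod.snd h1).symm ha2
            have h1 := hboth hp hq _ (Or.inl rfl)
            have h2 := hboth hp hq _ (Or.inr rfl)
            rw [h1.1, h1.2, h2.1, h2.2]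
            simp [piTilde_zero]
          · by_cases hp : pos i ∈ Q.map Prod.snd
            · obtain ⟨j, hj⟩ := exists_of_mem_labels hp
              have hn := nodup_concat hQ' k hq
              refine pair_of_mem t i k ha1 ha2 hQ' hj hq
                (fun hjk => (ih _ hn).2 ⟨j, k, hjk, sublist_concat hj _⟩) fun hjk => ?_
              have h0 := (ihs _ (nodup_swapLabels i hn)).1 (piCond_swapLabels_concat i hjk hj)
              rwa [swapLabels_swapLabels] at h0
            · exact pair_of_notMem t i k ha1 ha2 hp hq
                ((ih _ (nodup_concat hQ' k hp)).1 (Or.inl (notMem_concat hq hlt.ne)))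
      · intro h
        refine queueSum_swapLabels_succ_cons t i _ (thetaTilde_add t i) k _ _ Q ha
          (fun b hb1 hb2 => ?_) ?_
        · by_cases hb : b ∈ Q.map Prod.snd
          · rw [(hmem a b hb1 hb2 hb).1, (hmem a b hb1 hb2 hb).2]
            simp [thetaTilde_zero]
          · rw [hw b hb1 hb2, (ih b (nodup_concat hQ' k hb)).2 (h.rotate ha1),
              thetaTilde_C_mul_X_mul t i _ hb1 hb2]
        · have hpq : pos i ∈ Q.map Prod.snd ∧ posSucc i ∈ Q.map Prod.snd := by
            obtain ⟨j, k', hk, hs⟩ := h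
            rcases sublist_pair_cons hs with h | ⟨h1, h2⟩
            · exact ⟨mem_labels_of_mem (mem_of_sublist_pair h).1,
                mem_labels_of_mem (mem_of_sublist_pair h).2⟩
            · exact absurd (congrArg Prod.snd h1).symm ha1
          have h1 := hboth hpq.1 hpq.2 _ (Or.inl rfl)
          have h2 := hboth hpq.1 hpq.2 _ (Or.inr rfl)
          rw [h1.1, h1.2, h2.1, h2.2]
          simp [thetaTilde_zero]

end Intertwining

/-! ### Queues with dominance-ordered labels -/

section Sorted

variable {n : ℕ} {K : Type*} [Field K]

/-- Of two rows in this order in a queue, the one with the smaller label has strictly more boxes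
left if it comes first, and at least as many if it comes second. -/
def LabelOrdered (e f : ℕ × Fin n) : Prop :=
  (e.2 < f.2 → f.1 < e.1) ∧ (f.2 < e.2 → e.1 ≤ f.1)

/-- In a queue with ordered labels every row can only be filled with its own label, because all
smaller labels are in use in other rows. -/
theorem queueSum_of_labelOrdered (t : K) (Q : List (ℕ × Fin n)) :
    (Q.map Prod.snd).Nodup → (∀ a ∈ Q.map Prod.snd, ∀ b < a, b ∈ Q.map Prod.snd) →
      Q.Pairwise LabelOrdered →
      queueSum t Q = (Q.map fun e => (MvPolynomial.X e.2 ^ e.1 : MvPolynomial (Fin n) K)).prod := by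
  induction Q using queue_induction with
  | nil => intros; rw [queueSum_nil]; rfl
  | zero a Q ih =>
    intro hQ hd hp
    rw [List.map_cons, List.nodup_cons] at hQ
    rw [List.pairwise_cons] at hp
    rw [queueSum_zero_cons, List.map_cons, List.prod_cons, pow_zero, one_mul]
    refine ih hQ.2 (fun x hx b hb => ?_) hp.2
    rcases List.mem_cons.1 (hd x (List.mem_cons_of_mem _ hx) b hb) with h | h
    · obtain ⟨j, hj⟩ := exists_of_mem_labels hx
      exact absurd ((hp.1 _ hj).1 (h ▸ hb)) (Nat.not_lt_zero _)
    · exact h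
  | succ k a Q ih =>
    intro hQ hd hp
    rw [List.map_cons, List.nodup_cons] at hQ
    rw [List.pairwise_cons] at hp
    rw [queueSum_succ_cons, Finset.sum_eq_single a, stepWeight_self t k hQ.1, map_one, one_mul,
      ih (Q ++ [(k, a)]) (by simp) (nodup_concat hQ.2 k hQ.1)]
    · simp only [List.map_append, List.map_cons, List.map_nil, List.prod_append, List.prod_cons,
        List.prod_nil]
      ring
    · have hperm : ((Q ++ [(k, a)]).map Prod.snd).Perm (((k + 1, a) :: Q).map Prod.snd) := by
        rw [List.map_append]
        exact List.perm_append_singleton _ _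
      intro x hx b hb
      exact hperm.mem_iff.2 (hd x (hperm.mem_iff.1 hx) b hb)
    · rw [List.pairwise_append]
      refine ⟨hp.2, List.pairwise_singleton _ _, fun e he f hf => ?_⟩
      rw [List.mem_singleton] at hf
      subst hf
      have h := hp.1 e he
      exact ⟨fun h' => Nat.lt_of_succ_le (h.2 h'), fun h' => Nat.le_of_lt_succ (h.1 h')⟩
    · intro b _ hb
      rcases lt_or_gt_of_ne hb with h | h
      · have hbQ : b ∈ Q.map Prod.snd :=
          (List.mem_cons.1 (hd a List.mem_cons_self b h)).resolve_left hb
        rw [stepWeight_eq_zero_of_mem t k a hbQ, map_zero, zero_mul, zero_mul]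
      · rw [stepWeight_eq_zero_of_lt t k Q h, map_zero, zero_mul, zero_mul]
    · exact fun h => absurd (Finset.mem_univ a) h

end Sorted

/-! ### Sorting the basement -/

section Basement

universe u

variable {n : ℕ}

/-- The queue of a diagram with basement `σ`: its rows from bottom to top. -/
def initialQueue (σ : Equiv.Perm (Fin n)) (α : Fin n → ℕ) : List (ℕ × Fin n) :=
  (List.finRange n).map fun p => (α p.rev, σ p.rev)

/-- The row `r` is longer than `s`, or equally long and higher. -/
def Dominates (α : Fin n → ℕ) (r s : Fin n) : Prop :=
  α s < α r ∨ (α r = α s ∧ r < s)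

theorem Dominates.trans {α : Fin n → ℕ} {r s u : Fin n} (h : Dominates α r s)
    (h' : Dominates α s u) : Dominates α r u := by
  unfold Dominates at *
  omega

theorem Dominates.asymm {α : Fin n → ℕ} {r s : Fin n} (h : Dominates α r s) :
    ¬ Dominates α s r := by
  unfold Dominates at *
  omega

theorem Dominates.of_not {α : Fin n → ℕ} {r s : Fin n} (h : ¬ Dominates α r s) (hne : r ≠ s) :
    Dominates α s r := by
  unfold Dominates at *
  omega

/-- The basement `σ` with the labels `i` and `i + 1` exchanged. -/
def swapBasement (i : Fin (n - 1)) (σ : Equiv.Perm (Fin n)) : Equiv.Perm (Fin n) :=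
  σ.trans (Equiv.swap (pos i) (posSucc i))

theorem swapLabels_initialQueue (i : Fin (n - 1)) (σ : Equiv.Perm (Fin n)) (α : Fin n → ℕ) :
    swapLabels i (initialQueue (swapBasement i σ) α) = initialQueue σ α := by
  simp [swapLabels, initialQueue, swapBasement]

theorem nodup_initialQueue (σ : Equiv.Perm (Fin n)) (α : Fin n → ℕ) :
    ((initialQueue σ α).map Prod.snd).Nodup := by
  rw [initialQueue, List.map_map]
  exact (List.nodup_finRange n).map (σ.injective.comp Fin.rev_injective)

theorem pair_sublist_initialQueue (σ : Equiv.Perm (Fin n)) (α : Fin n → ℕ) {r s : Fin n}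
    (h : r < s) : List.Sublist [(α s, σ s), (α r, σ r)] (initialQueue σ α) := by
  have h1 : List.Sublist [s.rev, r.rev] (List.finRange n) := by
    refine List.sublist_of_subperm_of_pairwise (r := (· < ·)) ?_ ?_ ?_
    · refine (List.Nodup.subperm ?_ fun x _ => List.mem_finRange x)
      simp [h.ne']
    · simpa using h
    · exact List.pairwise_lt_finRange n
  have h2 := h1.map fun p => (α p.rev, σ p.rev)
  simpa [initialQueue] using h2

/-- If the row with the label `i + 1` dominates the row with the label `i`, exchanging these two
labels of the basement is undone by one of the operators. -/
theorem queueSum_initialQueue_of_dominates (α : Fin n → ℕ) (σ : Equiv.Perm (Fin n))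
    (i : Fin (n - 1)) (h : Dominates α (σ.symm (posSucc i)) (σ.symm (pos i))) :
    ∃ ρ : Letter n, ∀ (K : Type u) [Field K] (t : K), queueSum t (initialQueue σ α) =
      Letter.apply t ρ (queueSum t (initialQueue (swapBasement i σ) α)) := by
  have hs : swapBasement i σ (σ.symm (posSucc i)) = pos i := by simp [swapBasement]
  have hr : swapBasement i σ (σ.symm (pos i)) = posSucc i := by simp [swapBasement]
  have hn := nodup_initialQueue (swapBasement i σ) α
  have hne : σ.symm (pos i) ≠ σ.symm (posSucc i) :=
    fun h => (pos_lt_posSucc i).ne (σ.symm.injective h)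
  rcases lt_or_gt_of_ne hne with hlt | hlt
  · refine ⟨.theta i, fun K _ t => ?_⟩
    rw [← swapLabels_initialQueue i σ α]
    refine (queueSum_swapLabels t i _ hn).2
      ⟨α (σ.symm (posSucc i)), α (σ.symm (pos i)), ?_, ?_⟩
    · unfold Dominates at h
      omega
    · have h1 := pair_sublist_initialQueue (swapBasement i σ) α hlt
      rwa [hs, hr] at h1
  · refine ⟨.pi i, fun K _ t => ?_⟩
    rw [← swapLabels_initialQueue i σ α]
    refine (queueSum_swapLabels t i _ hn).1 <| Or.inr
      ⟨α (σ.symm (posSucc i)), α (σ.symm (pos i)), ?_, ?_⟩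
    · unfold Dominates at h
      omega
    · have h1 := pair_sublist_initialQueue (swapBasement i σ) α hlt
      rwa [hs, hr] at h1

open scoped Classical in
/-- The number of pairs of rows whose labels are not in the order of dominance. -/
noncomputable def misplaced (α : Fin n → ℕ) (σ : Equiv.Perm (Fin n)) : ℕ :=
  (Finset.univ.filter fun x : Fin n × Fin n => Dominates α x.1 x.2 ∧ σ x.2 < σ x.1).card

theorem misplaced_swapBasement_lt {α : Fin n → ℕ} {σ : Equiv.Perm (Fin n)} {i : Fin (n - 1)}
    (h : Dominates α (σ.symm (posSucc i)) (σ.symm (pos i))) :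
    misplaced α (swapBasement i σ) < misplaced α σ := by
  classical
  refine Finset.card_lt_card (Finset.ssubset_iff_of_subset ?_ |>.2
    ⟨(σ.symm (posSucc i), σ.symm (pos i)), ?_, ?_⟩)
  · rintro ⟨x, y⟩ hxy
    simp only [Finset.mem_filter, Finset.mem_univ, true_and] at hxy ⊢
    refine ⟨hxy.1, ?_⟩
    have h2 := hxy.2
    simp only [swapBasement, Equiv.trans_apply] at h2
    refine (swap_lt_swap_iff i (fun h' => ?_) fun h' => ?_).1 h2
    · rw [h'.1, h'.2, Equiv.swap_apply_left, Equiv.swap_apply_right] at h2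
      exact h2.not_gt (pos_lt_posSucc i)
    · rw [← h'.1, ← h'.2, Equiv.symm_apply_apply, Equiv.symm_apply_apply] at h
      exact h.asymm hxy.1
  · simpa using ⟨h, pos_lt_posSucc i⟩
  · intro h1
    have h2 := (Finset.mem_filter.1 h1).2.2
    simp only [swapBasement, Equiv.trans_apply, Equiv.apply_symm_apply, Equiv.swap_apply_left,
      Equiv.swap_apply_right] at h2
    exact h2.not_gt (pos_lt_posSucc i)

/-- If no two adjacent labels are misplaced, no two labels are, as dominance is a total order. -/
theorem dominates_of_forall_not {α : Fin n → ℕ} {σ : Equiv.Perm (Fin n)}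
    (h : ∀ i, ¬ Dominates α (σ.symm (posSucc i)) (σ.symm (pos i))) {a b : Fin n} (hab : a < b) :
    Dominates α (σ.symm a) (σ.symm b) := by
  obtain ⟨d, hd⟩ := Nat.exists_eq_add_of_lt hab
  induction d generalizing b with
  | zero =>
    have hi : a.val < n - 1 := by omega
    have ha : a = pos ⟨a, hi⟩ := rfl
    have hb : b = posSucc ⟨a, hi⟩ := Fin.ext hd
    have := h ⟨a, hi⟩
    rw [← ha, ← hb] at this
    exact Dominates.of_not this fun h' => hab.ne' (σ.symm.injective h')
  | succ d ih =>
    have hi : b.val - 1 < n - 1 := by omega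
    have hb : b = posSucc ⟨b.val - 1, hi⟩ := by
      apply Fin.ext
      simp only [posSucc]
      omega
    have h1 : a.val + d + 1 < n := by omega
    refine (ih (b := ⟨a.val + d + 1, h1⟩) (Fin.lt_def.2 (by simp only; omega)) rfl).trans ?_
    have hp : (⟨a.val + d + 1, h1⟩ : Fin n) = pos ⟨b.val - 1, hi⟩ := by
      apply Fin.ext
      simp only [pos]
      omega
    have := h ⟨b.val - 1, hi⟩
    rw [← hp, ← hb] at this
    refine Dominates.of_not this fun h' => ?_
    have := congrArg Fin.val (σ.symm.injective h')
    simp only at this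
    omega

theorem decRearrangement_eq {α : Fin n → ℕ} {τ : Equiv.Perm (Fin n)} (h : Antitone (α ∘ τ)) :
    decRearrangement α = α ∘ τ := by
  obtain ⟨τ', h'⟩ := decRearrangement_eq_comp_perm α
  rw [h']
  exact Tuple.unique_antitone (h' ▸ decRearrangement_antitone α) h

/-- If all labels are in the order of dominance, the only filling has constant rows. -/
theorem queueSum_initialQueue_eq_xPow {α : Fin n → ℕ} {σ : Equiv.Perm (Fin n)}
    (h : ∀ a b, a < b → Dominates α (σ.symm a) (σ.symm b)) (K : Type u) [Field K] (t : K) :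
    queueSum t (initialQueue σ α) = xPow K (decRearrangement α) := by
  have hanti : Antitone (α ∘ σ.symm) := by
    intro a b hab
    rcases hab.eq_or_lt with rfl | hab
    · exact le_rfl
    · have := h a b hab
      unfold Dominates at this
      simp only [Function.comp_apply]
      omega
  have h' : ∀ r s, σ r < σ s → Dominates α r s := fun r s hrs => by
    simpa using h _ _ hrs
  rw [queueSum_of_labelOrdered t _ (nodup_initialQueue σ α), decRearrangement_eq hanti, xPow,
    ← Equiv.prod_comp σ]
  · simp only [initialQueue, List.map_map, Function.comp_def, Equiv.symm_apply_apply]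
    rw [← Equiv.prod_comp Fin.revPerm, ← List.ofFn_eq_map, List.prod_ofFn]
    rfl
  · intro a _ b _
    refine List.mem_map.2 ⟨(α (σ.symm b), b), ?_, rfl⟩
    exact List.mem_map.2 ⟨(σ.symm b).rev, List.mem_finRange _, by simp⟩
  · rw [initialQueue, List.pairwise_map]
    refine (List.pairwise_lt_finRange n).imp fun {p p'} hp => ?_
    have hrev := Fin.rev_lt_rev.2 hp
    constructor
    · intro h1
      have := h' _ _ h1
      unfold Dominates at this
      simp only
      omega
    · intro h1
      have := h' _ _ h1
      unfold Dominates at this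
      simp only
      omega

theorem exists_word_queueSum_initialQueue (α : Fin n → ℕ) (σ : Equiv.Perm (Fin n)) :
    ∃ w : List (Letter n), ∀ (K : Type u) [Field K] (t : K),
      queueSum t (initialQueue σ α) = applyWord t w (xPow K (decRearrangement α)) := by
  induction hN : misplaced α σ using Nat.strong_induction_on generalizing σ with
  | _ N ih =>
    subst hN
    by_cases h : ∃ i, Dominates α (σ.symm (posSucc i)) (σ.symm (pos i))
    · obtain ⟨i, hi⟩ := h
      obtain ⟨w, hw⟩ := ih _ (misplaced_swapBasement_lt hi) (swapBasement i σ) rfl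
      obtain ⟨ρ, hρ⟩ := queueSum_initialQueue_of_dominates α σ i hi
      exact ⟨ρ :: w, fun K _ t => by rw [hρ K t, hw K t]; rfl⟩
    · exact ⟨[], fun K _ t => queueSum_initialQueue_eq_xPow
        (fun a b hab => dominates_of_forall_not (not_exists.1 h) hab) K t⟩

end Basement

/-! ### Reading a filling box by box -/

section Reading

variable {n : ℕ} {α : Fin n → ℕ}

/-- The place of a box in the reading order: column by column from left to right, each column from
bottom to top. Places of missing boxes are left vacant, so that the box to the right of `u` has
place `time u + n`. -/
def time (u : Box α) : ℕ := Box.col u * n + (n - 1 - (Box.row u).val)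

theorem row_box (u : Cell α) : Box.row (Cell.box u) = u.1 := rfl

theorem row_left (u : Cell α) : Box.row (Cell.left u) = u.1 := rfl

theorem col_box (u : Cell α) : Box.col (Cell.box u) = u.2.val + 1 := Fin.val_succ _

theorem col_left (u : Cell α) : Box.col (Cell.left u) = u.2.val := rfl

theorem col_le (u : Box α) : Box.col u ≤ α (Box.row u) := Nat.lt_succ_iff.1 u.2.isLt

theorem box_ext {u v : Box α} (h1 : Box.row u = Box.row v) (h2 : Box.col u = Box.col v) :
    u = v := by
  obtain ⟨r, c⟩ := u
  obtain ⟨s, d⟩ := v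
  obtain rfl : r = s := h1
  obtain rfl : c = d := Fin.ext h2
  rfl

theorem exists_box_eq {u : Box α} (h : Box.col u ≠ 0) : ∃ v : Cell α, Cell.box v = u := by
  have h1 := col_le u
  refine ⟨⟨Box.row u, ⟨Box.col u - 1, by omega⟩⟩, box_ext rfl ?_⟩
  rw [col_box]
  simp only
  omega

theorem exists_left_eq {u : Box α} (h : leg u ≠ 0) : ∃ v : Cell α, Cell.left v = u := by
  unfold leg at h
  exact ⟨⟨Box.row u, ⟨Box.col u, by omega⟩⟩, box_ext rfl rfl⟩

theorem left_injective : Function.Injective (Cell.left : Cell α → Box α) := by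
  rintro ⟨r, c⟩ ⟨s, d⟩ h
  obtain rfl : r = s := congrArg Box.row h
  obtain rfl : c = d := Fin.ext (congrArg Box.col h)
  rfl

theorem leg_left (u : Cell α) : leg (Cell.left u) = leg (Cell.box u) + 1 := by
  have := u.2.isLt
  unfold leg
  rw [row_left, row_box, col_left, col_box]
  omega

theorem time_box (u : Cell α) : time (Cell.box u) = time (Cell.left u) + n := by
  unfold time
  rw [row_left, row_box, col_left, col_box]
  ring

theorem time_lt_time_iff (u v : Box α) : time u < time v ↔
    Box.col u < Box.col v ∨ (Box.col u = Box.col v ∧ Box.row v < Box.row u) := by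
  have hu := (Box.row u).isLt
  have hv := (Box.row v).isLt
  rw [Fin.lt_def]
  unfold time
  rcases lt_trichotomy (Box.col u) (Box.col v) with h | h | h
  · have := Nat.mul_le_mul_right n (Nat.succ_le_of_lt h)
    rw [Nat.succ_mul] at this
    omega
  · rw [h]
    omega
  · have := Nat.mul_le_mul_right n (Nat.succ_le_of_lt h)
    rw [Nat.succ_mul] at this
    omega

theorem time_injective : Function.Injective (time : Box α → ℕ) := by
  intro u v h
  have h1 := time_lt_time_iff u v
  have h2 := time_lt_time_iff v u
  rw [Fin.lt_def] at h1 h2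
  exact box_ext (Fin.ext (by omega)) (by omega)

/-- The box `w` is read strictly between `d(u)` and `u`. -/
def Between (u : Cell α) (w : Box α) : Prop :=
  time (Cell.left u) < time w ∧ time w < time (Cell.box u)

theorem between_iff (u : Cell α) (w : Box α) : Between u w ↔
    (Box.col w = Box.col (Cell.box u) ∧ u.1 < Box.row w) ∨
    (Box.col w + 1 = Box.col (Cell.box u) ∧ Box.row w < u.1) := by
  rw [Between, time_lt_time_iff, time_lt_time_iff, row_left, row_box, col_left, col_box,
    Fin.lt_def, Fin.lt_def]
  omega

/-- Apart from pairs in the basement, whose entries are distinct, the pairs of boxes that may not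
have equal entries are those of a non-basement box `u` and a box read between `d(u)` and `u`. -/
theorem nonAttacking_iff (σ : Equiv.Perm (Fin n)) (F : Cell α → Fin n) :
    NonAttacking (augment σ F) ↔
      ∀ u w, Between u w → augment σ F w ≠ augment σ F (Cell.box u) := by
  constructor
  · intro h u w huw he
    rcases (between_iff u w).1 huw with ⟨h1, h2⟩ | ⟨h1, h2⟩
    · exact h (Cell.box u) w ⟨he.symm, h2, Or.inl h1.symm⟩
    · exact h w (Cell.box u) ⟨he, h2, Or.inr h1⟩
  · rintro h a b ⟨he, hr, hc⟩
    by_cases h0 : Box.col b = 0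
    · have ha : a = ⟨Box.row a, 0⟩ := box_ext rfl (show Box.col a = 0 by omega)
      have hb : b = ⟨Box.row b, 0⟩ := box_ext rfl h0
      rw [ha, hb, augment_basement, augment_basement] at he
      exact hr.ne (σ.injective he)
    · rcases hc with hc | hc
      · obtain ⟨u, rfl⟩ := exists_box_eq (u := a) (hc ▸ h0)
        exact h u b ((between_iff u b).2 (Or.inl ⟨hc.symm, hr⟩)) he.symm
      · obtain ⟨u, rfl⟩ := exists_box_eq h0
        exact h u a ((between_iff u a).2 (Or.inr ⟨hc, hr⟩)) he

theorem NonAttacking.ne_left {G : Box α → Fin n} (hG : NonAttacking G) {u : Cell α} {w : Box α}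
    (h : Between u w) : G w ≠ G (Cell.left u) := by
  rcases (between_iff u w).1 h with ⟨h1, h2⟩ | ⟨h1, h2⟩
  · exact fun he => hG (Cell.left u) w ⟨he.symm, h2, Or.inr (h1.trans (col_box u)).symm⟩
  · exact fun he => hG w (Cell.left u) ⟨he, h2, Or.inl (Nat.succ_injective
      (h1.trans (col_box u)))⟩

theorem immLeft_iff (a b : Box α) :
    ImmLeft a b ↔ ∃ u : Cell α, a = Cell.left u ∧ b = Cell.box u := by
  constructor
  · rintro ⟨h1, h2⟩
    obtain ⟨u, rfl⟩ := exists_box_eq (u := b) (by omega)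
    rw [col_box] at h2
    exact ⟨u, box_ext h1 (Nat.succ_injective h2), rfl⟩
  · rintro ⟨u, rfl, rfl⟩
    exact ⟨rfl, (col_box u).symm⟩

/-- The third boxes of the triples of types `A` and `B` over `d(u)`, `u` are the boxes read between
these two whose rows have at most as many boxes left. -/
theorem typeA_or_typeB_iff (u : Cell α) (w : Box α) :
    TypeA (Cell.left u) (Cell.box u) w ∨ TypeB (Cell.left u) (Cell.box u) w ↔
      Between u w ∧ leg w ≤ leg (Cell.box u) := by
  have hi : ImmLeft (Cell.left u) (Cell.box u) := (immLeft_iff _ _).2 ⟨u, rfl, rfl⟩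
  have hw := col_le w
  have hu := u.2.isLt
  rw [between_iff, TypeA, TypeB]
  unfold leg
  simp only [hi, true_and, row_box, row_left, col_box, col_left]
  constructor
  · rintro (⟨h1, h2, h3⟩ | ⟨h1, h2, h3⟩)
    · exact ⟨Or.inl ⟨h1, h2⟩, by omega⟩
    · exact ⟨Or.inr ⟨by omega, h2⟩, by omega⟩
  · rintro ⟨⟨h1, h2⟩ | ⟨h1, h2⟩, h3⟩
    · exact Or.inl ⟨h1, h2, by omega⟩
    · exact Or.inr ⟨by omega, h2, by omega⟩

theorem not_inversionTriple_iff {G : Box α → Fin n} (hG : NonAttacking G) {u : Cell α}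
    {w : Box α} (h : Between u w) (hw : G w ≠ G (Cell.box u))
    (hle : G (Cell.box u) ≤ G (Cell.left u)) :
    ¬ InversionTriple G (Cell.left u) (Cell.box u) w ↔
      G (Cell.box u) < G w ∧ G w < G (Cell.left u) := by
  have h2 := hG.ne_left h
  simp only [InversionTriple, CycIncreasing, Prod.Lex.toLex_lt_toLex, Fin.lt_def, Fin.le_def,
    ne_eq, Fin.ext_iff] at *
  omega

open scoped Classical in
/-- The number of triples of type `A` or `B` over the boxes `d(u)`, `u` whose third entry lies strictly
between the other two; in a non-attacking filling without descents these are the coinversions. -/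
noncomputable def coinvAt (G : Box α → Fin n) (u : Cell α) : ℕ :=
  (Finset.univ.filter fun w : Box α => Between u w ∧ leg w ≤ leg (Cell.box u) ∧
    G (Cell.box u) < G w ∧ G w < G (Cell.left u)).card

/-- A triple is determined by its box `b` and its third box. -/
theorem coinv_eq_sum {σ : Equiv.Perm (Fin n)} {F : Cell α → Fin n}
    (hG : NonAttacking (augment σ F))
    (hle : ∀ u, augment σ F (Cell.box u) ≤ augment σ F (Cell.left u)) :
    coinv (augment σ F) = ∑ u, coinvAt (augment σ F) u := by
  classical
  have e : (Σ u : Cell α, {w : Box α // Between u w ∧ leg w ≤ leg (Cell.box u) ∧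
      augment σ F (Cell.box u) < augment σ F w ∧ augment σ F w < augment σ F (Cell.left u)}) ≃
      {p : Box α × Box α × Box α // (TypeA p.1 p.2.1 p.2.2 ∨ TypeB p.1 p.2.1 p.2.2) ∧
        ¬ InversionTriple (augment σ F) p.1 p.2.1 p.2.2} := by
    refine Equiv.ofBijective (fun x => ⟨(Cell.left x.1, Cell.box x.1, x.2.1),
      (typeA_or_typeB_iff _ _).2 ⟨x.2.2.1, x.2.2.2.1⟩,
      (not_inversionTriple_iff hG x.2.2.1 ((nonAttacking_iff σ F).1 hG _ _ x.2.2.1)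
        (hle _)).2 x.2.2.2.2⟩) ⟨?_, ?_⟩
    · rintro ⟨u, w, hw⟩ ⟨v, z, hz⟩ h
      simp only [Subtype.mk.injEq, Prod.mk.injEq] at h
      obtain rfl := left_injective h.1
      obtain rfl := h.2.2
      rfl
    · rintro ⟨⟨a, b, w⟩, h1, h2⟩
      have hi : ImmLeft a b := h1.elim (fun h => h.1) fun h => h.1
      obtain ⟨u, rfl, rfl⟩ := (immLeft_iff a b).1 hi
      have h3 := (typeA_or_typeB_iff u w).1 h1
      exact ⟨⟨u, w, h3.1, h3.2, (not_inversionTriple_iff hG h3.1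
        ((nonAttacking_iff σ F).1 hG _ _ h3.1) (hle _)).1 h2⟩, rfl⟩
  rw [coinv, ← Nat.card_congr e, Nat.card_sigma]
  refine Finset.sum_congr rfl fun u _ => ?_
  rw [Nat.card_eq_fintype_card, Fintype.card_subtype, coinvAt]

end Reading

/-! ### The queue of a partially read filling -/

section Unrolling

variable {n : ℕ} {α : Fin n → ℕ} {K : Type*} [Field K]

open scoped Classical in
/-- The entry of a queue given by the box at the place `e` of the reading order, if there is one. -/
noncomputable def entryAt (G : Box α → Fin n) (e : ℕ) : Option (ℕ × Fin n) :=
  if h : ∃ u : Box α, time u = e then some (leg h.choose, G h.choose) else none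

theorem entryAt_time (G : Box α → Fin n) (u : Box α) : entryAt G (time u) = some (leg u, G u) := by
  have h : ∃ v : Box α, time v = time u := ⟨u, rfl⟩
  rw [entryAt, dif_pos h, time_injective h.choose_spec]

theorem entryAt_eq_none {G : Box α → Fin n} {e : ℕ} (h : ∀ u : Box α, time u ≠ e) :
    entryAt G e = none :=
  dif_neg fun ⟨u, hu⟩ => h u hu

theorem entryAt_eq_some_iff {G : Box α → Fin n} {e : ℕ} {x : ℕ × Fin n} :
    entryAt G e = some x ↔ ∃ u : Box α, time u = e ∧ (leg u, G u) = x := by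
  constructor
  · intro h
    by_cases hu : ∃ u : Box α, time u = e
    · obtain ⟨u, rfl⟩ := hu
      rw [entryAt_time] at h
      exact ⟨u, rfl, Option.some_injective _ h⟩
    · rw [entryAt_eq_none (not_exists.1 hu)] at h
      cases h
  · rintro ⟨u, rfl, rfl⟩
    exact entryAt_time G u

/-- The queue when all boxes at the places before `N + n` have been filled. It consists of the boxes
at the places `N, …, N + n - 1`: a row whose last box is before the place `N` has left the queue. -/
noncomputable def queueAt (G : Box α → Fin n) (N : ℕ) : List (ℕ × Fin n) :=
  (List.range' N n).filterMap (entryAt G)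

/-- The queue without the box at the place `N`. -/
noncomputable def restAt (G : Box α → Fin n) (N : ℕ) : List (ℕ × Fin n) :=
  (List.range' (N + 1) (n - 1)).filterMap (entryAt G)

theorem range'_eq_cons {m : ℕ} (hm : 0 < m) (N : ℕ) :
    List.range' N m = N :: List.range' (N + 1) (m - 1) := by
  obtain ⟨k, rfl⟩ := Nat.exists_eq_succ_of_ne_zero hm.ne'
  rfl

theorem range'_succ_eq_concat {m : ℕ} (hm : 0 < m) (N : ℕ) :
    List.range' (N + 1) m = List.range' (N + 1) (m - 1) ++ [N + m] := by
  obtain ⟨k, rfl⟩ := Nat.exists_eq_succ_of_ne_zero hm.ne'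
  rw [Nat.succ_eq_add_one, Nat.add_sub_cancel, List.range'_1_concat, Nat.add_right_comm,
    Nat.add_assoc]

theorem queueAt_eq_cons (G : Box α → Fin n) (u : Box α) :
    queueAt G (time u) = (leg u, G u) :: restAt G (time u) := by
  rw [queueAt, restAt, range'_eq_cons (lt_of_le_of_lt (Nat.zero_le _) (Box.row u).isLt),
    List.filterMap_cons_some (entryAt_time G u)]

theorem queueAt_succ_eq (G : Box α → Fin n) (hn : 0 < n) (N : ℕ) :
    queueAt G (N + 1) = restAt G N ++ (entryAt G (N + n)).toList := by
  rw [queueAt, restAt, range'_succ_eq_concat hn, List.filterMap_append]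
  congr 1

/-- A box at the place `N + n` is not in the basement, so its left neighbour is at the place `N`. -/
theorem exists_time_eq_of_time_eq_add {N : ℕ} {u : Box α} (h : time u = N + n) :
    ∃ v : Cell α, Cell.box v = u ∧ time (Cell.left v) = N := by
  have h0 : Box.col u ≠ 0 := by
    intro h0
    have := (Box.row u).isLt
    unfold time at h
    rw [h0] at h
    omega
  obtain ⟨v, rfl⟩ := exists_box_eq h0
  rw [time_box] at h
  exact ⟨v, rfl, by omega⟩

/-- Passing a place without a box to its right only removes finished rows. -/
theorem queueSum_queueAt_succ (t : K) (G : Box α → Fin n) {N : ℕ}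
    (h : ∀ u : Cell α, time (Cell.left u) ≠ N) :
    queueSum t (queueAt G N) = queueSum t (queueAt G (N + 1)) := by
  rcases Nat.eq_zero_or_pos n with hn | hn
  · simp [queueAt, hn]
  have hnone : entryAt G (N + n) = none := entryAt_eq_none fun u hu => by
    obtain ⟨v, _, hv⟩ := exists_time_eq_of_time_eq_add hu
    exact h v hv
  rw [queueAt_succ_eq G hn, hnone, Option.toList_none, List.append_nil]
  by_cases hu : ∃ u : Box α, time u = N
  · obtain ⟨u, rfl⟩ := hu
    have hl : leg u = 0 := by
      by_contra hl
      obtain ⟨v, rfl⟩ := exists_left_eq hl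
      exact h v rfl
    rw [queueAt_eq_cons, hl, queueSum_zero_cons]
  · rw [queueAt, restAt, range'_eq_cons hn,
      List.filterMap_cons_none (entryAt_eq_none (not_exists.1 hu))]

theorem queueAt_zero (σ : Equiv.Perm (Fin n)) (F : Cell α → Fin n) :
    queueAt (augment σ F) 0 = initialQueue σ α := by
  rw [queueAt, initialQueue, ← List.range_eq_range', ← List.map_coe_finRange_eq_range,
    List.filterMap_map]
  rw [← List.filterMap_eq_map]
  congr 1
  ext p : 1
  have hp : time (⟨p.rev, 0⟩ : Box α) = p.val := by
    have := p.isLt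
    simp only [time, Box.col, Box.row, Fin.val_rev, Fin.val_zero]
    omega
  rw [Function.comp_apply, ← hp, entryAt_time]
  rfl

/-- The boxes at the places before `N + n` only involve the cells whose left neighbour comes before
the place `N`. -/
theorem augment_congr (σ : Equiv.Perm (Fin n)) {F F' : Cell α → Fin n} {N : ℕ}
    (h : ∀ u, time (Cell.left u) < N → F' u = F u) {w : Box α} (hw : time w < N + n) :
    augment σ F' w = augment σ F w := by
  by_cases h0 : Box.col w = 0
  · have hb : w = ⟨Box.row w, 0⟩ := box_ext rfl h0
    rw [hb, augment_basement, augment_basement]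
  · obtain ⟨u, rfl⟩ := exists_box_eq h0
    rw [time_box] at hw
    rw [augment_box, augment_box, h u (by omega)]

theorem restAt_congr (σ : Equiv.Perm (Fin n)) {F F' : Cell α → Fin n} {N : ℕ}
    (h : ∀ u, time (Cell.left u) < N → F' u = F u) :
    restAt (augment σ F') N = restAt (augment σ F) N := by
  refine List.filterMap_congr fun e he => ?_
  rw [List.mem_range'_1] at he
  by_cases hu : ∃ u : Box α, time u = e
  · obtain ⟨u, rfl⟩ := hu
    rw [entryAt_time, entryAt_time, augment_congr σ h (by omega)]
  · rw [entryAt_eq_none (not_exists.1 hu), entryAt_eq_none (not_exists.1 hu)]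

/-- The weight of a cell in a filling: that of the step from the entry on its left to its own entry,
in the queue from which it is filled. -/
noncomputable def cellWeight (t : K) (σ : Equiv.Perm (Fin n)) (F : Cell α → Fin n)
    (u : Cell α) : K :=
  stepWeight t (leg (Cell.box u)) (augment σ F (Cell.left u)) (augment σ F (Cell.box u))
    (restAt (augment σ F) (time (Cell.left u)))

open scoped Classical in
/-- The sum over all fillings that extend a partial filling, restricted to the factors of the new
cells, is the generating function of the current queue. -/
theorem sum_extensions_eq_queueSum (t : K) (σ : Equiv.Perm (Fin n)) (N : ℕ) (F : Cell α → Fin n) :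
    ∑ F' : Cell α → Fin n with ∀ u, time (Cell.left u) < N → F' u = F u,
      ∏ u : Cell α with N ≤ time (Cell.left u),
        (MvPolynomial.C (cellWeight t σ F' u) * MvPolynomial.X (F' u)) =
      queueSum t (queueAt (augment σ F) N) := by
  obtain ⟨B, hB⟩ : ∃ B, ∀ u : Box α, time u < B :=
    ⟨(Finset.univ.sup (time : Box α → ℕ)) + 1,
      fun u => Nat.lt_succ_of_le (Finset.le_sup (f := time) (Finset.mem_univ u))⟩
  obtain ⟨d, hd⟩ : ∃ d, B ≤ N + d := ⟨B, Nat.le_add_left _ _⟩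
  induction d generalizing N F with
  | zero =>
    have hq : queueAt (augment σ F) N = [] := by
      rw [queueAt, List.filterMap_eq_nil_iff]
      intro e he
      rw [List.mem_range'_1] at he
      exact entryAt_eq_none fun u hu => by have := hB u; omega
    have h1 : (Finset.univ.filter fun F' : Cell α → Fin n =>
        ∀ u, time (Cell.left u) < N → F' u = F u) = {F} := by
      ext F'
      simp only [Finset.mem_filter, Finset.mem_univ, true_and, Finset.mem_singleton]
      exact ⟨fun h => funext fun u => h u (lt_of_lt_of_le (hB _) hd), fun h _ _ => h ▸ rfl⟩
    have h2 : (Finset.univ.filter fun u : Cell α => N ≤ time (Cell.left u)) = ∅ := by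
      refine Finset.filter_eq_empty_iff.2 fun u _ => ?_
      have := hB (Cell.left u)
      omega
    rw [hq, queueSum_nil, h1, h2, Finset.sum_singleton, Finset.prod_empty]
  | succ d ih =>
    have hd' : B ≤ (N + 1) + d := by omega
    by_cases hu : ∃ u : Cell α, time (Cell.left u) = N
    · obtain ⟨u, rfl⟩ := hu
      have huniq : ∀ v : Cell α, time (Cell.left v) = time (Cell.left u) → v = u :=
        fun v hv => left_injective (time_injective hv)
      have hn : 0 < n := lt_of_le_of_lt (Nat.zero_le _) u.1.isLt
      rw [queueAt_eq_cons, leg_left, queueSum_succ_cons,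
        ← Finset.sum_fiberwise (g := fun F' : Cell α → Fin n => F' u)]
      refine Finset.sum_congr rfl fun b _ => ?_
      -- `F'` ranges over the fillings that agree with `F` before `u` and have `F' u = b`.
      have hagree : ∀ v, time (Cell.left v) < time (Cell.left u) →
          Function.update F u b v = F v := fun v hv =>
        Function.update_of_ne (fun h => by rw [h] at hv; exact hv.false) _ _
      have hset : ((Finset.univ.filter fun F' : Cell α → Fin n =>
          ∀ v, time (Cell.left v) < time (Cell.left u) → F' v = F v).filter
            fun F' => F' u = b) =
          Finset.univ.filter fun F' : Cell α → Fin n =>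
            ∀ v, time (Cell.left v) < time (Cell.left u) + 1 → F' v = Function.update F u b v := by
        ext F'
        simp only [Finset.mem_filter, Finset.mem_univ, true_and]
        constructor
        · rintro ⟨h1, h2⟩ v hv
          rcases Nat.lt_succ_iff_lt_or_eq.1 hv with hv | hv
          · rw [h1 v hv, hagree v hv]
          · rw [huniq v hv, h2, Function.update_self]
        · intro h
          refine ⟨fun v hv => ?_, ?_⟩
          · rw [h v (Nat.lt_succ_of_lt hv), hagree v hv]
          · rw [h u (Nat.lt_succ_self _), Function.update_self]
      have hcells : (Finset.univ.filter fun v : Cell α =>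
            time (Cell.left u) ≤ time (Cell.left v)) =
          insert u (Finset.univ.filter fun v : Cell α =>
            time (Cell.left u) + 1 ≤ time (Cell.left v)) := by
        ext v
        simp only [Finset.mem_filter, Finset.mem_univ, true_and, Finset.mem_insert]
        constructor
        · intro h
          rcases h.eq_or_lt with h | h
          · exact Or.inl (huniq v h.symm)
          · exact Or.inr h
        · rintro (rfl | h)
          · exact le_rfl
          · exact (Nat.lt_of_succ_le h).le
      have hq : queueAt (augment σ (Function.update F u b)) (time (Cell.left u) + 1) =
          restAt (augment σ F) (time (Cell.left u)) ++ [(leg (Cell.box u), b)] := by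
        rw [queueAt_succ_eq _ hn, restAt_congr σ hagree, ← time_box, entryAt_time, augment_box,
          Function.update_self, Option.toList_some]
      rw [hset, ← hq, ← ih _ _ hd', Finset.mul_sum]
      refine Finset.sum_congr rfl fun F' hF' => ?_
      have hF1 := (Finset.mem_filter.1 hF').2
      have hF2 : ∀ v, time (Cell.left v) < time (Cell.left u) → F' v = F v := fun v hv => by
        rw [hF1 v (Nat.lt_succ_of_lt hv), hagree v hv]
      have hFu : F' u = b := by rw [hF1 u (Nat.lt_succ_self _), Function.update_self]
      rw [hcells, Finset.prod_insert (by simp), cellWeight, restAt_congr σ hF2,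
        augment_congr σ hF2 (Nat.lt_add_of_pos_right hn), augment_box, hFu]
    · rw [not_exists] at hu
      have h1 : ∀ v : Cell α, time (Cell.left v) < N ↔ time (Cell.left v) < N + 1 := fun v => by
        have := hu v
        omega
      have h2 : ∀ v : Cell α, N ≤ time (Cell.left v) ↔ N + 1 ≤ time (Cell.left v) := fun v => by
        have := hu v
        omega
      rw [queueSum_queueAt_succ t _ hu, ← ih _ _ hd']
      simp only [h1, h2]

end Unrolling

/-! ### The `t`-atom as the generating function of a queue -/

section Atom

universe u

variable {n : ℕ} {α : Fin n → ℕ} {K : Type u} [Field K]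

/-- The rest of the queue at `d(u)` consists of the boxes read between `d(u)` and `u`. -/
theorem mem_range'_iff_between {u : Cell α} {w : Box α} :
    time w ∈ List.range' (time (Cell.left u) + 1) (n - 1) ↔ Between u w := by
  have := u.1.isLt
  rw [List.mem_range'_1, Between, time_box]
  omega

theorem mem_labels_restAt (G : Box α → Fin n) (u : Cell α) (b : Fin n) :
    b ∈ (restAt G (time (Cell.left u))).map Prod.snd ↔ ∃ w, Between u w ∧ G w = b := by
  simp only [restAt, List.mem_map, List.mem_filterMap, entryAt_eq_some_iff]
  constructor
  · rintro ⟨x, ⟨e, he, w, rfl, rfl⟩, rfl⟩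
    exact ⟨w, mem_range'_iff_between.1 he, rfl⟩
  · rintro ⟨w, hw, rfl⟩
    exact ⟨_, ⟨_, mem_range'_iff_between.2 hw, w, rfl, rfl⟩, rfl⟩

theorem countP_restAt (G : Box α → Fin n) (u : Cell α) :
    (restAt G (time (Cell.left u))).countP (fun e => decide (e.1 ≤ leg (Cell.box u) ∧
      G (Cell.box u) < e.2 ∧ e.2 < G (Cell.left u))) = coinvAt G u := by
  classical
  rw [restAt, List.countP_filterMap, List.countP_eq_length_filter,
    ← List.toFinset_card_of_nodup ((List.nodup_range' (step := 1)).filter _), coinvAt,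
    ← Finset.card_image_of_injective _ (time_injective (α := α))]
  congr 1
  ext e
  simp only [List.mem_toFinset, List.mem_filter, Finset.mem_image, Finset.mem_filter,
    Finset.mem_univ, true_and]
  constructor
  · rintro ⟨he, h⟩
    by_cases hw : ∃ w : Box α, time w = e
    · obtain ⟨w, rfl⟩ := hw
      rw [entryAt_time] at h
      exact ⟨w, ⟨mem_range'_iff_between.1 he, by simpa using h⟩, rfl⟩
    · rw [entryAt_eq_none (not_exists.1 hw)] at h
      simp at h
  · rintro ⟨w, ⟨hw, h⟩, rfl⟩
    exact ⟨mem_range'_iff_between.2 hw, by rw [entryAt_time]; simpa using h⟩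

/-- At `q = 0` the coefficient of a filling is the product of the weights of its cells; both vanish
if the filling has a descent or an attacking pair. -/
theorem prod_cellWeight (t : K) (σ : Equiv.Perm (Fin n)) (F : Cell α → Fin n)
    [Decidable (NonAttacking (augment σ F))] :
    ∏ u, cellWeight t σ F u = if NonAttacking (augment σ F) then
      (0 : K) ^ maj (augment σ F) * t ^ coinv (augment σ F) *
      ∏ u : Cell α,
        if augment σ F (Cell.left u) ≠ augment σ F (Cell.box u) then
          (1 - t) / (1 - (0 : K) ^ (1 + leg (Cell.box u)) * t ^ (1 + arm (Cell.box u)))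
        else 1
      else 0 := by
  split_ifs with hG
  · by_cases hle : ∀ u, augment σ F (Cell.box u) ≤ augment σ F (Cell.left u)
    · have hmaj : maj (augment σ F) = 0 :=
        Finset.sum_eq_zero fun u _ => if_neg (hle u).not_gt
      rw [hmaj, pow_zero, one_mul, coinv_eq_sum hG hle, ← Finset.prod_pow_eq_pow_sum,
        ← Finset.prod_mul_distrib]
      refine Finset.prod_congr rfl fun u _ => ?_
      have hmem : augment σ F (Cell.box u) ∉
          (restAt (augment σ F) (time (Cell.left u))).map Prod.snd := by
        rw [mem_labels_restAt]
        rintro ⟨w, hw, he⟩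
        exact (nonAttacking_iff σ F).1 hG u w hw he
      rw [cellWeight, stepWeight, if_pos ⟨hle u, hmem⟩, countP_restAt, add_comm 1 (leg _),
        pow_succ, mul_zero, zero_mul, sub_zero, div_one]
      simp only [ne_eq, ite_not]
    · obtain ⟨u, hu⟩ := not_forall.1 hle
      have hmaj : maj (augment σ F) ≠ 0 := fun h => by
        have := Finset.sum_eq_zero_iff.1 h u (Finset.mem_univ u)
        rw [if_pos (not_le.1 hu)] at this
        exact Nat.succ_ne_zero _ this
      rw [zero_pow hmaj, zero_mul, zero_mul]
      exact Finset.prod_eq_zero (Finset.mem_univ u) (stepWeight_eq_zero_of_lt _ _ _ (not_le.1 hu))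
  · rw [nonAttacking_iff] at hG
    simp only [not_forall, not_not] at hG
    obtain ⟨u, w, hw, he⟩ := hG
    exact Finset.prod_eq_zero (Finset.mem_univ u)
      (stepWeight_eq_zero_of_mem _ _ _ ((mem_labels_restAt _ _ _).2 ⟨w, hw, he⟩))

theorem tAtom_eq_queueSum (σ : Equiv.Perm (Fin n)) (α : Fin n → ℕ) (t : K) :
    tAtom σ α t = queueSum t (initialQueue σ α) := by
  classical
  have : Nonempty (Cell α → Fin n) := ⟨fun u => u.1⟩
  obtain ⟨F₀⟩ := this
  have h := sum_extensions_eq_queueSum t σ 0 F₀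
  rw [queueAt_zero] at h
  rw [← h, tAtom, macdonaldE, NAF, Finset.sum_filter]
  simp only [Nat.not_lt_zero, IsEmpty.forall_iff, implies_true, Finset.filter_true,
    Nat.zero_le]
  refine Finset.sum_congr rfl fun F _ => ?_
  rw [Finset.prod_mul_distrib, ← map_prod, prod_cellWeight]
  split_ifs
  · rfl
  · rw [map_zero, zero_mul]

end Atom

end PermutedBasement

theorem mainTheorem12 {n : ℕ} (α : Fin n → ℕ) (σ : Equiv.Perm (Fin n)) :
    ∃ w : List (PermutedBasement.Letter n),
      ∀ (K : Type*) [Field K] (t : K),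
        PermutedBasement.tAtom σ α t =
          PermutedBasement.applyWord t w
            (PermutedBasement.xPow K (PermutedBasement.decRearrangement α)) := by
  obtain ⟨w, hw⟩ := PermutedBasement.exists_word_queueSum_initialQueue α σ
  exact ⟨w, fun K _ t => (PermutedBasement.tAtom_eq_queueSum σ α t).trans (hw K t)⟩
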